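/- **Setting.** For a complex sequence $a=(a_j)_{j\in\mathbb Z}$ let $T_n(a)=(a_{i-j})_{i,j=1}^n$ be the $n\times n$ Toeplitz matrix with input $a$. Let $P_n=(\delta_{i+j,\,n+1})_{i,j=1}^n$ be the backward identity matrix, and let $H_{n,s}(a)=P_nT_n(a)$ be the symmetric Hankel matrix with input $a$. For an $n\times n$ random matrix $B$ with entries having all moments finite, put $\varphi_n(B)=\frac1n\mathbf E[\operatorname{Tr}B]$. A $*$-probability space is a pair $(\mathcal A,\varphi)$ of a unital complex $*$-algebra and a linear functional $\varphi$ with $\varphi(\mathbf 1)=1$ and $\varphi(xx^*)\ge 0$ for all $x\in\mathcal A$. A family $(A_{\iota,n})_\iota$ of sequences of $n\times n$ random matrices, with entries having all moments finite, *converges jointly in $*$-distribution* if there are a $*$-probability space $(\mathcal A,\varphi)$ and elements $x_\iota\in\mathcal A$ such that $$\lim_{n\to\infty}\varphi_n\big(A_{\iota_1,n}^{\epsilon_1}\cdots A_{\iota_k,n}^{\epsilon_k}\big)=\varphi\big(x_{\iota_1}^{\epsilon_1}\cdots x_{\iota_k}^{\epsilon_k}\big)$$ for all $k\ge1$, all indices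 $\iota_1,\dots,\iota_k$ and all $\epsilon_1,\dots,\epsilon_k\in\{1,*\}$, where $*$ on matrices is the conjugate transpose. **Random inputs.** An array $a_{j,n}=x_{j,n}+\mathrm i\,y_{j,n}$ ($n\ge1$, $j\in\mathbb Z$) of complex random variables is called *pair-correlated* if $\mathbf E\,a_{j,n}=0$; for every $n\ge 1$ the vectors $(x_{j,n},x_{-j,n},y_{j,n},y_{-j,n})$, $j\ge0$, are independent; and there are real constants $\sigma_x,\sigma_y,\rho_1,\dots,\rho_6$ and $(c_k)_{k\ge1}$ such that, for all $n\ge1$: 1. $\mathbf E[x_{j,n}^2]=\sigma_x^2$ and $\mathbf E[y_{j,n}^2]=\sigma_y^2$ for all $j\in\mathbb Z$; 2. for all $j\ge1$: $\mathbf E[x_{j,n}y_{j,n}]=\rho_1$, $\mathbf E[x_{j,n}x_{-j,n}]=\rho_2$, $\mathbf E[x_{j,n}y_{-j,n}]=\rho_3$, $\mathbf E[x_{-j,n}y_{j,n}]=\rho_4$, $\mathbf E[y_{j,n}y_{-j,n}]=\rho_5$, $\mathbf E[x_{-j,n}y_{-j,n}]=\rho_6$; 3. $\mathbf E|x_{j,n}|^k\le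 c_k<\infty$ and $\mathbf E|y_{j,n}|^k\le c_k<\infty$ for all $j\in\mathbb Z$ and $k\ge1$. **Corollary 2.1.** Let $u^{(1)},\dots,u^{(r)}$ be pair-correlated arrays on one probability space, each with its own constants, such that for every $n\ge1$ the sequences $(u^{(k)}_{j,n})_{j\in\mathbb Z}$, $1\le k\le r$, are independent. Let $t,h:\{1,\dots,m\}\to\{1,\dots,r\}$ be injective, and let $T_n^{(i)}$ be the Toeplitz matrix with input $(u^{(t(i))}_{j,n})_j$ and $H_{n,s}^{(i)}$ the symmetric Hankel matrix with input $(u^{(h(i))}_{j,n})_j$, $1\le i\le m$. (So the $T_n^{(i)}$ are independent and the $H_{n,s}^{(i)}$ are independent; the two families are independent of each other if $t$ and $h$ have disjoint ranges, and they may also share inputs.) Let $D_n^{(i)}=T_n(d^{(i)})$ and $\tilde H_{n,s}^{(i)}=H_{n,s}(e^{(i)})$, $1\le i\le m$, be deterministic Toeplitz and deterministic symmetric Hankel matrices, where $d^{(i)}$ and $e^{(i)}$ are complex sequences (not depending on $n$) with $\sum_{k\in\mathbb Z}|d^{(i)}_k|<\infty$ and $\sum_{k\in\mathbb Z}|e^{(i)}_k|<\infty$.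 Then the whole family $$\big\{\,n^{-1/2}T_n^{(i)},\ n^{-1/2}H_{n,s}^{(i)},\ D_n^{(i)},\ \tilde H_{n,s}^{(i)},\ P_n\ ;\ 1\le i\le m\,\big\}$$ converges jointly in $*$-distribution as $n\to\infty$; in particular, so does every subfamily. -/

import Mathlib

open MeasureTheory ProbabilityTheory Filter Topology

noncomputable section

namespace ToeplitzHankel

/-- The `n × n` Toeplitz matrix with input sequence `a`: the `(i, j)` entry is `a (i - j)`. -/
def toeplitz (a : ℤ → ℂ) (n : ℕ) : Matrix (Fin n) (Fin n) ℂ :=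
  Matrix.of fun i j => a (((i : ℕ) : ℤ) - ((j : ℕ) : ℤ))

/-- The backward identity permutation matrix: ones on the anti-diagonal, zeros elsewhere
(indices run through `0, …, n - 1`). -/
def backwardIdentity (n : ℕ) : Matrix (Fin n) (Fin n) ℂ :=
  Matrix.of fun i j => if (i : ℕ) + (j : ℕ) + 1 = n then 1 else 0

/-- The symmetric Hankel matrix with input sequence `a`, the product of the backward identity and
the Toeplitz matrix with input sequence `a`. -/
def symmHankel (a : ℤ → ℂ) (n : ℕ) : Matrix (Fin n) (Fin n) ℂ :=
  backwardIdentity n * toeplitz a n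

/-- The second order parameters of a pair-correlated input sequence. -/
structure CorrParams where
  sigmaX : ℝ
  sigmaY : ℝ
  rho1 : ℝ
  rho2 : ℝ
  rho3 : ℝ
  rho4 : ℝ
  rho5 : ℝ
  rho6 : ℝ

variable {Ω : Type*} [MeasurableSpace Ω]

/-- A triangular array `a n j = x n j + i y n j` (`n ≥ 1`, `j ∈ ℤ`) of centered complex random
variables whose pairs `(a n j, a n (-j))`, `j ≥ 0`, are independent for every `n`, with
second moments that depend neither on `n` nor on `j`, and with all moments uniformly bounded. -/
structure IsPairCorrelated (μ : Measure Ω) (a : ℕ → ℤ → Ω → ℂ) (q : CorrParams) : Prop where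
  measurable : ∀ n, 1 ≤ n → ∀ j, Measurable (a n j)
  mean_zero : ∀ n, 1 ≤ n → ∀ j, ∫ ω, a n j ω ∂μ = 0
  indep : ∀ n, 1 ≤ n →
    iIndepFun (fun (j : ℕ) (ω : Ω) => (a n (j : ℤ) ω, a n (-(j : ℤ)) ω)) μ
  sq_x : ∀ n, 1 ≤ n → ∀ j, ∫ ω, (a n j ω).re ^ 2 ∂μ = q.sigmaX ^ 2
  sq_y : ∀ n, 1 ≤ n → ∀ j, ∫ ω, (a n j ω).im ^ 2 ∂μ = q.sigmaY ^ 2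
  corr1 : ∀ n, 1 ≤ n → ∀ j, 1 ≤ j → ∫ ω, (a n j ω).re * (a n j ω).im ∂μ = q.rho1
  corr2 : ∀ n, 1 ≤ n → ∀ j, 1 ≤ j → ∫ ω, (a n j ω).re * (a n (-j) ω).re ∂μ = q.rho2
  corr3 : ∀ n, 1 ≤ n → ∀ j, 1 ≤ j → ∫ ω, (a n j ω).re * (a n (-j) ω).im ∂μ = q.rho3
  corr4 : ∀ n, 1 ≤ n → ∀ j, 1 ≤ j → ∫ ω, (a n (-j) ω).re * (a n j ω).im ∂μ = q.rho4
  corr5 : ∀ n, 1 ≤ n → ∀ j, 1 ≤ j → ∫ ω, (a n j ω).im * (a n (-j) ω).im ∂μ = q.rho5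
  corr6 : ∀ n, 1 ≤ n → ∀ j, 1 ≤ j → ∫ ω, (a n (-j) ω).re * (a n (-j) ω).im ∂μ = q.rho6
  moments : ∃ c : ℕ → ℝ, ∀ k, 1 ≤ k → ∀ n, 1 ≤ n → ∀ j,
    Integrable (fun ω => |(a n j ω).re| ^ k) μ ∧ ∫ ω, |(a n j ω).re| ^ k ∂μ ≤ c k ∧
    Integrable (fun ω => |(a n j ω).im| ^ k) μ ∧ ∫ ω, |(a n j ω).im| ^ k ∂μ ≤ c k

/-- The state `φₙ(B) = (1/n) E[Tr B]` on `n × n` random matrices. -/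
def expTrace (μ : Measure Ω) {n : ℕ} (B : Ω → Matrix (Fin n) (Fin n) ℂ) : ℂ :=
  (n : ℂ)⁻¹ * ∫ ω, (B ω).trace ∂μ

/-- All entries of the random matrix have finite moments of all orders. -/
def HasAllMoments (μ : Measure Ω) {n : ℕ} (B : Ω → Matrix (Fin n) (Fin n) ℂ) : Prop :=
  ∀ i j, ∀ p : ℕ, MemLp (fun ω => B ω i j) (p : ENNReal) μ

/-- A state on a unital `*`-algebra: a linear functional `φ` with `φ(1) = 1` and `φ(x x*) ≥ 0`. -/
structure IsState {𝒜 : Type*} [Ring 𝒜] [StarRing 𝒜] [Algebra ℂ 𝒜] (φ : 𝒜 →ₗ[ℂ] ℂ) : Prop where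
  map_one : φ 1 = 1
  nonneg : ∀ x : 𝒜, ∃ r : ℝ, 0 ≤ r ∧ φ (x * star x) = (r : ℂ)

/-- The word `x_{i₁}^{ε₁} ⋯ x_{iₖ}^{εₖ}`; the letter `(i, false)` stands for `x i` and the letter
`(i, true)` for `(x i)*`. -/
def starWord {ι : Type*} {R : Type*} [Monoid R] [Star R] (x : ι → R) (w : List (ι × Bool)) : R :=
  (w.map fun l => if l.2 then star (x l.1) else x l.1).prod

/-- Joint convergence in `*`-distribution of a family of sequences of random matrices (with finite
moments) to a family of elements of some `*`-probability space `(𝒜, φ)`. -/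
def ConvergeJointly {ι : Type*} (μ : Measure Ω)
    (A : ι → (n : ℕ) → Ω → Matrix (Fin n) (Fin n) ℂ) : Prop :=
  (∀ i n, 1 ≤ n → HasAllMoments μ (A i n)) ∧
  ∃ (𝒜 : Type) (_ : Ring 𝒜) (_ : StarRing 𝒜) (_ : Algebra ℂ 𝒜) (_ : StarModule ℂ 𝒜)
    (φ : 𝒜 →ₗ[ℂ] ℂ) (x : ι → 𝒜), IsState φ ∧
    ∀ w : List (ι × Bool),
      Tendsto (fun n : ℕ => expTrace μ (fun ω => starWord (fun i => A i n ω) w)) atTop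
        (𝓝 (φ (starWord x w)))

/-- Labels of the `4 m + 1` sequences of matrices. -/
inductive Label (m : ℕ) : Type
  | randToeplitz (i : Fin m)
  | randHankel (i : Fin m)
  | detToeplitz (i : Fin m)
  | detHankel (i : Fin m)
  | backward

/-- The scaled random Toeplitz matrices with inputs `a i`, the scaled random symmetric Hankel
matrices with inputs `b i`, the deterministic Toeplitz matrices with inputs `d i`, the deterministic
symmetric Hankel matrices with inputs `e i`, and the backward identity. -/
def collection {m : ℕ} (a b : Fin m → ℕ → ℤ → Ω → ℂ) (d e : Fin m → ℤ → ℂ) :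
    Label m → (n : ℕ) → Ω → Matrix (Fin n) (Fin n) ℂ
  | .randToeplitz i, n, ω => ((Real.sqrt n : ℝ) : ℂ)⁻¹ • toeplitz (fun j => a i n j ω) n
  | .randHankel i, n, ω => ((Real.sqrt n : ℝ) : ℂ)⁻¹ • symmHankel (fun j => b i n j ω) n
  | .detToeplitz i, n, _ => toeplitz (d i) n
  | .detHankel i, n, _ => symmHankel (e i) n
  | .backward, n, _ => backwardIdentity n

end ToeplitzHankel

end

/-!
The normalized trace of a word in the matrices is a sum over closed paths in `{0, …, n - 1}`, each
step being a shift (Toeplitz) or a reflected shift (Hankel) by the index of the input entry used.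
With the indices of the deterministic inputs fixed, the tuples of random indices are sorted by the
signs and the relative order of their absolute values. A class in which some absolute value occurs
only once contributes nothing; a class with a zero index or an absolute value occurring at least
three times has too few free indices; in a class of pairs the joint moment of the entries is
constant and the paths are the lattice points of a dilated polytope, so that after normalization
their number converges to a volume. Dominated convergence handles the sum over the deterministic
indices. The limits of all words then define a state on the free `*`-algebra.
-/

noncomputable section

namespace ToeplitzHankel

section LatticeCount

theorem abs_card_filter_sub_card_filter_le {α : Type*} (s : Finset α) (P Q : α → Prop)
    [DecidablePred P] [DecidablePred Q] :
    |((s.filter P).card : ℝ) - (s.filter Q).card| ≤ (s.filter fun x => ¬(P x ↔ Q x)).card := by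
  have key (P Q : α → Prop) [DecidablePred P] [DecidablePred Q] : ((s.filter P).card : ℝ) ≤
      (s.filter Q).card + (s.filter fun x => ¬(P x ↔ Q x)).card := by
    classical
    refine mod_cast (Finset.card_le_card fun x => ?_).trans (Finset.card_union_le _ _)
    simp only [Finset.mem_union, Finset.mem_filter]
    tauto
  have h := key Q P
  simp only [iff_comm (a := Q _)] at h
  rw [abs_le]
  constructor <;> linarith [key P Q]

theorem abs_card_filter_forall_sub_le {α γ : Type*} (s : Finset α) (C : Finset γ)
    (P Q : γ → α → Prop) [∀ c, DecidablePred (P c)] [∀ c, DecidablePred (Q c)] :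
    |((s.filter fun x => ∀ c ∈ C, P c x).card : ℝ) - (s.filter fun x => ∀ c ∈ C, Q c x).card| ≤
      ∑ c ∈ C, ((s.filter fun x => ¬(P c x ↔ Q c x)).card : ℝ) := by
  classical
  refine (abs_card_filter_sub_card_filter_le _ _ _).trans ?_
  refine mod_cast (Finset.card_le_card fun x hx => ?_).trans Finset.card_biUnion_le
  obtain ⟨hxs, hne⟩ := Finset.mem_filter.1 hx
  simp only [Finset.mem_biUnion, Finset.mem_filter]
  by_contra! hcon
  exact hne (forall₂_congr fun c hc => hcon c hc hxs)

theorem two_mul_add_one_pow_le {n : ℕ} (hn : 1 ≤ n) (k : ℕ) :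
    ((2 * n + 1 : ℕ) : ℝ) ^ k ≤ 3 ^ k * (n : ℝ) ^ k := by
  rw [← mul_pow]
  gcongr
  norm_cast
  omega

theorem span_basisFun_eq_range_intCast {ι : Type*} [Finite ι] :
    (Submodule.span ℤ (Set.range (Pi.basisFun ℝ ι)) : Set (ι → ℝ)) =
      Set.range fun (x : ι → ℤ) i => (x i : ℝ) := by
  ext y
  simp only [SetLike.mem_coe, Module.Basis.mem_span_iff_repr_mem, Pi.basisFun_repr,
    Set.mem_range, funext_iff, algebraMap_int_eq, eq_intCast]
  exact Classical.skolem

variable {ι κ : Type*} [Fintype ι]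

open Pointwise in
theorem tendsto_card_lattice_div_pow {s : Set (ι → ℝ)} (hbdd : Bornology.IsBounded s)
    (hmeas : MeasurableSet s) (hconv : Convex ℝ s) :
    Tendsto (fun n : ℕ => (Nat.card {x : ι → ℤ // (fun i => (x i : ℝ) / n) ∈ s} : ℝ) /
      (n : ℝ) ^ Fintype.card ι) atTop (𝓝 (volume.real s)) := by
  refine (tendsto_card_div_pow_atTop_volume s hbdd hmeas
    (hconv.addHaar_frontier volume)).congr' ?_
  filter_upwards [eventually_ge_atTop 1] with n hn
  have hn0 : (n : ℝ) ≠ 0 := by positivity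
  let f : (ι → ℤ) → ι → ℝ := fun x i => (x i : ℝ) / n
  have hf : Function.Injective f := fun x y hxy => by
    simpa [f, funext_iff, div_left_inj' hn0] using hxy
  have himage : s ∩ (n : ℝ)⁻¹ • (Submodule.span ℤ (Set.range (Pi.basisFun ℝ ι)) : Set (ι → ℝ)) =
      f '' {x | f x ∈ s} := by
    rw [span_basisFun_eq_range_intCast, ← Set.image_smul, ← Set.range_comp, Set.inter_comm,
      ← Set.image_preimage_eq_range_inter]
    have hcomp : f = (fun y => (n : ℝ)⁻¹ • y) ∘ fun x i => (x i : ℝ) := by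
      ext x i; exact div_eq_inv_mul _ _
    rw [← hcomp]
    rfl
  rw [himage, Nat.card_image_of_injective hf]
  rfl

/-- An integer affine form `∑ i, coeff i * x i + slope * n + offset` in lattice variables `x` and
a scale `n`. -/
structure AffineForm (ι : Type*) where
  coeff : ι → ℤ
  slope : ℤ
  offset : ℤ

/-- The part of an affine form that is homogeneous in the lattice variables and the scale. -/
def AffineForm.leading (c : AffineForm ι) (n : ℕ) (x : ι → ℤ) : ℤ :=
  ∑ i, c.coeff i * x i + c.slope * n

/-- The value of an affine form. -/
def AffineForm.eval (c : AffineForm ι) (n : ℕ) (x : ι → ℤ) : ℤ :=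
  c.leading n x + c.offset

/-- Integer-valued functions of the scale and the lattice variables given by an affine form. -/
def IsAffine (g : ℕ → (ι → ℤ) → ℤ) : Prop :=
  ∃ c : AffineForm ι, ∀ n x, g n x = c.eval n x

/-- Families of lattice polyhedra, indexed by the scale, cut out by finitely many integer affine
inequalities in the lattice variables and the scale. -/
def IsPoly (Q : ℕ → (ι → ℤ) → Prop) : Prop :=
  ∃ C : Finset (AffineForm ι), ∀ n x, Q n x ↔ ∀ c ∈ C, c.eval n x ≤ 0

namespace IsAffine

variable {g g' : ℕ → (ι → ℤ) → ℤ}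

theorem const (c : ℤ) : IsAffine (fun _ (_ : ι → ℤ) => c) :=
  ⟨⟨0, 0, c⟩, fun n x => by simp [AffineForm.eval, AffineForm.leading]⟩

theorem scale : IsAffine (fun n (_ : ι → ℤ) => (n : ℤ)) :=
  ⟨⟨0, 1, 0⟩, fun n x => by simp [AffineForm.eval, AffineForm.leading]⟩

theorem coord (i : ι) : IsAffine (fun _ (x : ι → ℤ) => x i) := by
  classical
  exact ⟨⟨Pi.single i 1, 0, 0⟩, fun n x => by
    simp [AffineForm.eval, AffineForm.leading, Pi.single_apply]⟩

theorem add (hg : IsAffine g) (hg' : IsAffine g') : IsAffine (fun n x => g n x + g' n x) := by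
  obtain ⟨c, h⟩ := hg
  obtain ⟨c', h'⟩ := hg'
  refine ⟨⟨c.coeff + c'.coeff, c.slope + c'.slope, c.offset + c'.offset⟩, fun n x => ?_⟩
  simp only [h, h', AffineForm.eval, AffineForm.leading, Pi.add_apply, add_mul,
    Finset.sum_add_distrib]
  ring

theorem const_mul (k : ℤ) (hg : IsAffine g) : IsAffine (fun n x => k * g n x) := by
  obtain ⟨c, h⟩ := hg
  refine ⟨⟨fun i => k * c.coeff i, k * c.slope, k * c.offset⟩, fun n x => ?_⟩
  simp only [h, AffineForm.eval, AffineForm.leading, mul_add, Finset.mul_sum, mul_assoc]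

theorem sub (hg : IsAffine g) (hg' : IsAffine g') : IsAffine (fun n x => g n x - g' n x) := by
  simpa only [sub_eq_add_neg, neg_one_mul] using hg.add (hg'.const_mul (-1))

theorem sum (s : Finset κ) {g : κ → ℕ → (ι → ℤ) → ℤ} (hg : ∀ k, IsAffine (g k)) :
    IsAffine (fun n x => ∑ k ∈ s, g k n x) := by
  classical
  induction s using Finset.induction_on with
  | empty => simpa using const 0
  | insert k s hk ih => simpa [Finset.sum_insert hk] using (hg k).add ih

end IsAffine

namespace IsPoly

variable {g g' : ℕ → (ι → ℤ) → ℤ}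

theorem le (hg : IsAffine g) (hg' : IsAffine g') : IsPoly (fun n x => g n x ≤ g' n x) := by
  obtain ⟨c, h⟩ := hg.sub hg'
  exact ⟨{c}, fun n x => by simp [← h]⟩

theorem lt (hg : IsAffine g) (hg' : IsAffine g') : IsPoly (fun n x => g n x < g' n x) := by
  simpa only [Int.lt_iff_add_one_le] using le (hg.add (.const 1)) hg'

theorem and {Q Q' : ℕ → (ι → ℤ) → Prop} (hQ : IsPoly Q) (hQ' : IsPoly Q') :
    IsPoly (fun n x => Q n x ∧ Q' n x) := by
  classical
  obtain ⟨C, h⟩ := hQ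
  obtain ⟨C', h'⟩ := hQ'
  exact ⟨C ∪ C', fun n x => by simp only [h, h', Finset.forall_mem_union]⟩

theorem all [Finite κ] {Q : κ → ℕ → (ι → ℤ) → Prop} (hQ : ∀ k, IsPoly (Q k)) :
    IsPoly (fun n x => ∀ k, Q k n x) := by
  classical
  cases nonempty_fintype κ
  choose C hC using hQ
  refine ⟨Finset.univ.biUnion C, fun n x => ?_⟩
  simp only [hC, Finset.mem_biUnion, Finset.mem_univ, true_and, forall_exists_index]
  exact forall_comm

theorem eq (hg : IsAffine g) (hg' : IsAffine g') : IsPoly (fun n x => g n x = g' n x) := by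
  simpa only [le_antisymm_iff] using (le hg hg').and (le hg' hg)

theorem sign_eq (hg : IsAffine g) (s : SignType) :
    IsPoly (fun n x => SignType.sign (g n x) = s) := by
  cases s
  · simpa only [SignType.zero_eq_zero, sign_eq_zero_iff] using eq hg (.const 0)
  · simpa only [SignType.neg_eq_neg_one, sign_eq_neg_one_iff] using lt hg (.const 0)
  · simpa only [SignType.pos_eq_one, sign_eq_one_iff] using lt (.const 0) hg

theorem le_iff (hg : IsAffine g) (hg' : IsAffine g') (p : Prop) :
    IsPoly (fun n x => g n x ≤ g' n x ↔ p) := by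
  by_cases hp : p
  · simpa only [hp, iff_true] using le hg hg'
  · simpa only [hp, iff_false, not_le] using lt hg' hg

theorem comp [Fintype κ] {Q : ℕ → (κ → ℤ) → Prop} (hQ : IsPoly Q)
    {g : κ → ℕ → (ι → ℤ) → ℤ} (hg : ∀ k, IsAffine (g k)) :
    IsPoly (fun n x => Q n (fun k => g k n x)) := by
  obtain ⟨C, hC⟩ := hQ
  have heval (c : AffineForm κ) : IsAffine fun n x => c.eval n fun k => g k n x :=
    ((IsAffine.sum _ fun k => (hg k).const_mul _).add (IsAffine.scale.const_mul _)).add (.const _)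
  have hle : IsPoly fun n x => ∀ c : C, c.1.eval n (fun k => g k n x) ≤ 0 :=
    IsPoly.all fun c => le (heval c) (.const 0)
  simpa only [hC, Subtype.forall] using hle

end IsPoly

open scoped Classical in
/-- The lattice points of the cube `[-n, n]^ι`. -/
def box (ι : Type*) [Fintype ι] (n : ℕ) : Finset (ι → ℤ) :=
  Fintype.piFinset fun _ => Finset.Icc (-(n : ℤ)) n

theorem mem_box {n : ℕ} {x : ι → ℤ} : x ∈ box ι n ↔ ∀ i, -(n : ℤ) ≤ x i ∧ x i ≤ n := by
  simp [box, Fintype.mem_piFinset]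

theorem card_box (n : ℕ) : (box ι n).card = (2 * n + 1) ^ Fintype.card ι := by
  classical
  have : ((n : ℤ) + 1 - -n).toNat = 2 * n + 1 := by omega
  rw [box, Fintype.card_piFinset, Finset.prod_const, Finset.card_univ, Int.card_Icc, this]

open scoped Classical in
theorem card_slab_le (c : AffineForm ι) (hc : c.coeff ≠ 0) (b n : ℕ) :
    ((box ι n).filter fun x => |c.leading n x| ≤ b).card
      ≤ (2 * n + 1) ^ (Fintype.card ι - 1) * (2 * b + 1) := by
  obtain ⟨i₀, hi₀⟩ := Function.ne_iff.1 hc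
  have hcard : ((box {i // i ≠ i₀} n) ×ˢ Finset.Icc (-(b : ℤ)) b).card
      = (2 * n + 1) ^ (Fintype.card ι - 1) * (2 * b + 1) := by
    rw [Finset.card_product, card_box, Int.card_Icc]
    congr 2
    · simp [Fintype.card_subtype_compl]
    · omega
  rw [← hcard]
  -- A point of the slab is determined by its other coordinates and by the value of the form.
  refine Finset.card_le_card_of_injOn (fun x => (fun i => x i, c.leading n x)) ?_ ?_
  · intro x hx
    simp only [Finset.coe_filter, Set.mem_ofPred_eq, mem_box] at hx
    simp only [Finset.coe_product, Set.mem_prod, Finset.mem_coe, mem_box, Finset.mem_Icc]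
    exact ⟨fun i => hx.1 i, abs_le.1 hx.2⟩
  · intro x _ y _ hxy
    obtain ⟨hne, hlead⟩ := Prod.mk.inj hxy
    have hoff : ∀ i, i ≠ i₀ → x i = y i := fun i hi => congrFun hne ⟨i, hi⟩
    have hsum : ∑ i, c.coeff i * (x i - y i) = 0 := by
      simp only [mul_sub, Finset.sum_sub_distrib]
      simpa [AffineForm.leading, sub_eq_zero] using hlead
    rw [Fintype.sum_eq_single i₀ fun i hi => by simp [hoff i hi]] at hsum
    have hat : x i₀ = y i₀ := sub_eq_zero.1 ((mul_eq_zero.1 hsum).resolve_left hi₀)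
    exact funext fun i => (eq_or_ne i i₀).elim (fun hi => hi ▸ hat) (hoff i)

open scoped Classical in
theorem tendsto_card_slab_div_pow (c : AffineForm ι) (hc : ¬(c.coeff = 0 ∧ c.slope = 0)) (b : ℕ) :
    Tendsto (fun n : ℕ => (((box ι n).filter fun x => |c.leading n x| ≤ b).card : ℝ) /
      (n : ℝ) ^ Fintype.card ι) atTop (𝓝 0) := by
  by_cases hc0 : c.coeff = 0
  · refine tendsto_const_nhds.congr' ?_
    filter_upwards [eventually_gt_atTop b] with n hn
    have hslope : 1 ≤ |c.slope| := Int.one_le_abs fun h => hc ⟨hc0, h⟩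
    rw [Finset.filter_false_of_mem, Finset.card_empty, Nat.cast_zero, zero_div]
    intro x _
    simp only [AffineForm.leading, hc0, Pi.zero_apply, zero_mul, Finset.sum_const_zero, zero_add,
      abs_mul, Nat.abs_cast, not_le]
    nlinarith
  · obtain ⟨i, -⟩ := Function.ne_iff.1 hc0
    have hpos : 0 < Fintype.card ι := Fintype.card_pos_iff.2 ⟨i⟩
    set d := Fintype.card ι
    have hpow : Tendsto (fun n : ℕ => (n : ℝ) ^ (d - 1) / (n : ℝ) ^ d) atTop (𝓝 0) :=
      (tendsto_pow_div_pow_atTop_zero (Nat.sub_one_lt hpos.ne')).comp tendsto_natCast_atTop_atTop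
    have hlim := hpow.mul_const (3 ^ (d - 1) * (2 * (b : ℝ) + 1))
    rw [zero_mul] at hlim
    refine squeeze_zero' (Eventually.of_forall fun n => by positivity) ?_ hlim
    filter_upwards [eventually_ge_atTop 1] with n hn
    rw [div_mul_eq_mul_div]
    gcongr
    calc (((box ι n).filter fun x => |c.leading n x| ≤ b).card : ℝ)
      _ ≤ ((2 * n + 1 : ℕ) : ℝ) ^ (d - 1) * (2 * b + 1) := mod_cast card_slab_le c hc0 b n
      _ ≤ (3 ^ (d - 1) * (n : ℝ) ^ (d - 1)) * (2 * b + 1) := by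
          gcongr; exact two_mul_add_one_pow_le hn _
      _ = (n : ℝ) ^ (d - 1) * (3 ^ (d - 1) * (2 * b + 1)) := by ring

open scoped Classical in
theorem tendsto_card_eval_iff_leading (c : AffineForm ι)
    (hc : c.coeff = 0 → c.slope = 0 → c.offset ≤ 0) :
    Tendsto (fun n : ℕ => (((box ι n).filter fun x =>
      ¬(c.eval n x ≤ 0 ↔ c.leading n x ≤ 0)).card : ℝ) / (n : ℝ) ^ Fintype.card ι)
      atTop (𝓝 0) := by
  by_cases hc0 : c.coeff = 0 ∧ c.slope = 0
  · simp [AffineForm.eval, AffineForm.leading, hc0.1, hc0.2, hc hc0.1 hc0.2]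
  · refine squeeze_zero (fun n => by positivity) (fun n => ?_)
      (tendsto_card_slab_div_pow c hc0 c.offset.natAbs)
    gcongr with x
    simp only [AffineForm.eval, Int.natCast_natAbs]
    cases abs_cases c.offset <;> cases abs_cases (c.leading n x) <;> omega

open scoped Classical in
theorem exists_tendsto_card_leading (C : Finset (AffineForm ι)) :
    ∃ L : ℝ, Tendsto (fun n : ℕ => (((box ι n).filter fun x =>
      ∀ c ∈ C, c.leading n x ≤ 0).card : ℝ) / (n : ℝ) ^ Fintype.card ι) atTop (𝓝 L) := by
  let s : Set (ι → ℝ) := Set.Icc (-1) 1 ∩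
    ⋂ c ∈ C, {y : ι → ℝ | ∑ i, (c.coeff i : ℝ) * y i ≤ -c.slope}
  have hclosed : IsClosed s := isClosed_Icc.inter
    (isClosed_biInter fun c _ => isClosed_le (by fun_prop) continuous_const)
  have hbdd : Bornology.IsBounded s :=
    (Metric.isBounded_Icc (-1 : ι → ℝ) 1).subset Set.inter_subset_left
  have hconv : Convex ℝ s := (convex_Icc _ _).inter <| convex_iInter₂ fun c _ =>
    convex_halfSpace_le
      (f := fun y : ι → ℝ => (fun i => (c.coeff i : ℝ)) ⬝ᵥ y)
      ⟨dotProduct_add _, fun r => dotProduct_smul r _⟩ _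
  refine ⟨_, (tendsto_card_lattice_div_pow hbdd hclosed.measurableSet hconv).congr' ?_⟩
  filter_upwards [eventually_ge_atTop 1] with n hn
  have hn0 : (0 : ℝ) < n := mod_cast hn
  have hleading (c : AffineForm ι) (x : ι → ℤ) :
      ∑ i, (c.coeff i : ℝ) * (x i / n) ≤ -c.slope ↔ c.leading n x ≤ 0 := by
    simp only [← mul_div_assoc, ← Finset.sum_div, div_le_iff₀ hn0, ← Int.cast_nonpos (R := ℝ),
      AffineForm.leading, Int.cast_add, Int.cast_sum, Int.cast_mul, Int.cast_natCast]
    constructor <;> intro h <;> linarith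
  rw [Nat.subtype_card]
  intro x
  simp only [s, Finset.mem_filter, mem_box, Set.mem_inter_iff, Set.mem_Icc, Pi.le_def,
    Set.mem_iInter, Set.mem_ofPred_eq, hleading, Pi.neg_apply, Pi.one_apply, le_div_iff₀ hn0,
    div_le_iff₀ hn0, neg_one_mul, one_mul, forall_and]
  norm_cast

open scoped Classical in
theorem IsPoly.exists_tendsto_card {Q : ℕ → (ι → ℤ) → Prop} (hQ : IsPoly Q) :
    ∃ L : ℝ, Tendsto (fun n : ℕ => (((box ι n).filter (Q n)).card : ℝ) /
      (n : ℝ) ^ Fintype.card ι) atTop (𝓝 L) := by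
  obtain ⟨C, hC⟩ := hQ
  by_cases hbad : ∃ c ∈ C, c.coeff = 0 ∧ c.slope = 0 ∧ 0 < c.offset
  · obtain ⟨c, hc, hcoeff, hslope, hoffset⟩ := hbad
    have hempty (n : ℕ) (x : ι → ℤ) : ¬ Q n x := fun hx => by
      have := (hC n x).1 hx c hc
      simp only [AffineForm.eval, AffineForm.leading, hcoeff, hslope, Pi.zero_apply, zero_mul,
        Finset.sum_const_zero] at this
      omega
    exact ⟨0, by simp [hempty]⟩
  push Not at hbad
  obtain ⟨L, hL⟩ := exists_tendsto_card_leading C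
  have herr := tendsto_finsetSum C fun c hc => tendsto_card_eval_iff_leading c (hbad c hc)
  simp only [Finset.sum_const_zero] at herr
  refine ⟨L, hL.congr_dist (squeeze_zero (fun n => dist_nonneg) (fun n => ?_) herr)⟩
  rw [Real.dist_eq, ← sub_div, abs_div, abs_of_nonneg (by positivity : (0 : ℝ) ≤ (n : ℝ) ^ _),
    ← Finset.sum_div, abs_sub_comm, Finset.filter_congr fun x _ => hC n x]
  gcongr
  exact abs_card_filter_forall_sub_le _ C (fun c x => c.eval n x ≤ 0) fun c x => c.leading n x ≤ 0

end LatticeCount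

section PatternSums

variable {ρ : Type*}

/-- The signs of the coordinates of an integer vector and the order of their absolute values. -/
def pattern (v : ρ → ℤ) : (ρ → SignType) × (ρ → ρ → Prop) :=
  (fun q => SignType.sign (v q), fun q q' => |v q| ≤ |v q'|)

theorem pattern_eq_iff {v w : ρ → ℤ} : pattern v = pattern w ↔
    (∀ q, SignType.sign (v q) = SignType.sign (w q)) ∧
      ∀ q q', |v q| ≤ |v q'| ↔ |w q| ≤ |w q'| := by
  simp [pattern, Prod.ext_iff, funext_iff]

theorem pattern_eq_iff_sign_mul {v w : ρ → ℤ} : pattern v = pattern w ↔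
    (∀ q, SignType.sign (v q) = SignType.sign (w q)) ∧
      ∀ q q', (SignType.sign (w q) : ℤ) * v q ≤ (SignType.sign (w q') : ℤ) * v q' ↔
        |w q| ≤ |w q'| := by
  rw [pattern_eq_iff]
  refine and_congr_right fun hsign => ?_
  simp only [← hsign, sign_mul_self]

theorem abs_eq_iff_of_pattern_eq {v w : ρ → ℤ} (h : pattern v = pattern w) (q q' : ρ) :
    |v q| = |v q'| ↔ |w q| = |w q'| := by
  simp only [le_antisymm_iff, (pattern_eq_iff.1 h).2]

variable [Fintype ρ]

/-- Every absolute value among the coordinates is attained at least twice. -/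
def Partnered (v : ρ → ℤ) : Prop :=
  ∀ q, 2 ≤ (Finset.univ.filter fun q' => |v q'| = |v q|).card

/-- The coordinates do not vanish, and every absolute value among them is attained exactly
twice. -/
def Generic (v : ρ → ℤ) : Prop :=
  ∀ q, v q ≠ 0 ∧ (Finset.univ.filter fun q' => |v q'| = |v q|).card = 2

/-- The properties of the joint moments, as functions of the input indices, that govern the
asymptotics of normalized sums of moments. -/
structure IsMomentFunction (E : ℕ → (ρ → ℤ) → ℂ) : Prop where
  bounded : ∃ M : ℝ, ∀ n, 1 ≤ n → ∀ v, ‖E n v‖ ≤ M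
  eq_zero : ∀ n, 1 ≤ n → ∀ v, ¬ Partnered v → E n v = 0
  generic : ∀ n n', 1 ≤ n → 1 ≤ n' → ∀ v v', pattern v = pattern v' → Generic v → E n v = E n' v'

/-- The nonzero absolute values of the coordinates, the degrees of freedom of a pattern class. -/
def absValues (v : ρ → ℤ) : Finset ℤ := (Finset.univ.image fun q => |v q|).erase 0

theorem abs_mem_absValues {v : ρ → ℤ} {q : ρ} : |v q| ∈ absValues v ↔ v q ≠ 0 := by
  simp [absValues]

theorem exists_abs_eq {v : ρ → ℤ} {a : ℤ} (ha : a ∈ absValues v) : ∃ q, v q ≠ 0 ∧ |v q| = a := by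
  obtain ⟨q, -, rfl⟩ := Finset.mem_image.1 (Finset.mem_of_mem_erase ha)
  exact ⟨q, abs_mem_absValues.1 ha, rfl⟩

theorem Partnered.two_le_card_fiber {v : ρ → ℤ} (hv : Partnered v) {a : ℤ} (ha : a ∈ absValues v) :
    2 ≤ (Finset.univ.filter fun q => |v q| = a).card := by
  obtain ⟨q, -, rfl⟩ := exists_abs_eq ha
  exact hv q

theorem sum_card_fiber_absValues (v : ρ → ℤ) :
    ∑ a ∈ absValues v, (Finset.univ.filter fun q => |v q| = a).card =
      (Finset.univ.filter fun q => v q ≠ 0).card := by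
  rw [Finset.card_eq_sum_card_fiberwise (f := fun q => |v q|) (t := absValues v)
    fun q hq => abs_mem_absValues.2 (Finset.mem_filter.1 hq).2]
  refine Finset.sum_congr rfl fun a ha => congrArg _ (Finset.ext fun q => ?_)
  simp only [Finset.mem_filter, Finset.mem_univ, true_and, iff_and_self]
  rintro rfl
  exact abs_mem_absValues.1 ha

theorem Partnered.two_mul_card_le {v : ρ → ℤ} (hv : Partnered v) :
    2 * (absValues v).card ≤ Fintype.card ρ :=
  calc 2 * (absValues v).card
    _ = ∑ _a ∈ absValues v, 2 := by rw [Finset.sum_const, smul_eq_mul, mul_comm]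
    _ ≤ _ := Finset.sum_le_sum fun a ha => hv.two_le_card_fiber ha
    _ = (Finset.univ.filter fun q => v q ≠ 0).card := sum_card_fiber_absValues v
    _ ≤ Fintype.card ρ := Finset.card_le_univ _

theorem Partnered.generic {v : ρ → ℤ} (hv : Partnered v)
    (hcard : 2 * (absValues v).card = Fintype.card ρ) : Generic v := by
  have hsum : ∑ _a ∈ absValues v, 2 =
      ∑ a ∈ absValues v, (Finset.univ.filter fun q => |v q| = a).card := by
    refine le_antisymm (Finset.sum_le_sum fun a ha => hv.two_le_card_fiber ha) ?_
    rw [sum_card_fiber_absValues, Finset.sum_const, smul_eq_mul, mul_comm, hcard]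
    exact Finset.card_le_univ _
  have hne : ∀ q, v q ≠ 0 := by
    have huniv : Finset.univ.filter (fun q => v q ≠ 0) = Finset.univ := by
      rw [← Finset.card_eq_iff_eq_univ, ← sum_card_fiber_absValues, ← hsum, Finset.sum_const,
        smul_eq_mul, mul_comm, hcard]
    simpa using Finset.filter_eq_self.1 huniv
  exact fun q => ⟨hne q, ((Finset.sum_eq_sum_iff_of_le fun a ha => hv.two_le_card_fiber ha).1 hsum
    _ (abs_mem_absValues.2 (hne q))).symm⟩

/-- The vector with the signs of `v₀` whose coordinates of absolute value `|v₀ q|` are replaced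
by the prescribed value `y |v₀ q|`. The extra coordinate `none` is the starting index of a path. -/
def extend (v₀ : ρ → ℤ) (y : Option (absValues v₀) → ℤ) : Option ρ → ℤ
  | none => y none
  | some q => SignType.sign (v₀ q) *
      if h : v₀ q ≠ 0 then y (some ⟨|v₀ q|, abs_mem_absValues.2 h⟩) else 0

theorem extend_some_of_ne_zero {v₀ : ρ → ℤ} (y : Option (absValues v₀) → ℤ) {q : ρ}
    (hq : v₀ q ≠ 0) : extend v₀ y (some q) =
      SignType.sign (v₀ q) * y (some ⟨|v₀ q|, abs_mem_absValues.2 hq⟩) := by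
  rw [extend, dif_pos hq]

theorem extend_some_of_eq_zero {v₀ : ρ → ℤ} (y : Option (absValues v₀) → ℤ) {q : ρ}
    (hq : v₀ q = 0) : extend v₀ y (some q) = 0 := by
  simp [extend, hq]

theorem abs_sign_eq_one {a : ℤ} (ha : a ≠ 0) : |(SignType.sign a : ℤ)| = 1 := by
  rcases lt_or_gt_of_ne ha with h | h <;> simp [sign_neg, sign_pos, h]

theorem extend_injective (v₀ : ρ → ℤ) : Function.Injective (extend v₀) := by
  intro y y' h
  funext o
  rcases o with _ | ⟨a, ha⟩
  · exact congrFun h none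
  · obtain ⟨q, hq, rfl⟩ := exists_abs_eq ha
    have hval := congrFun h (some q)
    rw [extend_some_of_ne_zero _ hq, extend_some_of_ne_zero _ hq] at hval
    exact mul_left_cancel₀ (abs_ne_zero.1 (abs_sign_eq_one hq ▸ one_ne_zero)) hval

theorem extend_mem_box {v₀ : ρ → ℤ} {y : Option (absValues v₀) → ℤ} {n : ℕ} :
    extend v₀ y ∈ box (Option ρ) n ↔ y ∈ box (Option (absValues v₀)) n := by
  have habs {q : ρ} (hq : v₀ q ≠ 0) :
      |extend v₀ y (some q)| = |y (some ⟨|v₀ q|, abs_mem_absValues.2 hq⟩)| := by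
    rw [extend_some_of_ne_zero _ hq, abs_mul, abs_sign_eq_one hq, one_mul]
  simp only [mem_box, ← abs_le]
  refine ⟨fun h o => ?_, fun h o => ?_⟩
  · rcases o with _ | ⟨a, ha⟩
    · exact h none
    · obtain ⟨q, hq, rfl⟩ := exists_abs_eq ha
      exact habs hq ▸ h (some q)
  · rcases o with _ | q
    · exact h none
    · rcases eq_or_ne (v₀ q) 0 with hq | hq
      · simp [extend_some_of_eq_zero y hq]
      · exact (habs hq).trans_le (h _)

theorem exists_extend_eq {v₀ : ρ → ℤ} {x : Option ρ → ℤ} (hx : pattern (x ∘ some) = pattern v₀) :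
    ∃ y, extend v₀ y = x := by
  choose r _ habs using fun a : absValues v₀ => exists_abs_eq a.2
  refine ⟨fun o => o.elim (x none) fun a => |x (some (r a))|, funext fun o => ?_⟩
  have hsign := (pattern_eq_iff.1 hx).1
  rcases o with _ | q
  · rfl
  · rcases eq_or_ne (v₀ q) 0 with hq | hq
    · rw [extend_some_of_eq_zero _ hq, eq_comm, ← sign_eq_zero_iff]
      exact (hsign q).trans (by rw [hq, sign_zero])
    · have hrep : |x (some (r ⟨|v₀ q|, abs_mem_absValues.2 hq⟩))| = |x (some q)| :=
        (abs_eq_iff_of_pattern_eq hx _ _).2 (habs _)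
      rw [extend_some_of_ne_zero _ hq, Option.elim_some, hrep, ← hsign]
      exact sign_mul_abs _

open scoped Classical in
theorem card_pattern_class_eq (v₀ : ρ → ℤ) (n : ℕ) (S : (Option ρ → ℤ) → Prop) :
    ((box (Option ρ) n).filter fun x => S x ∧ pattern (x ∘ some) = pattern v₀).card =
    ((box (Option (absValues v₀)) n).filter fun y =>
      S (extend v₀ y) ∧ pattern (extend v₀ y ∘ some) = pattern v₀).card := by
  refine (Finset.card_nbij (extend v₀) (fun y hy => ?_) (extend_injective v₀).injOn
    fun x hx => ?_).symm
  · simpa [extend_mem_box] using hy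
  · simp only [Finset.coe_filter, Set.mem_ofPred_eq] at hx
    obtain ⟨y, rfl⟩ := exists_extend_eq hx.2.2
    exact ⟨y, by simpa [extend_mem_box] using hx, rfl⟩

open scoped Classical in
theorem card_pattern_class_le (v₀ : ρ → ℤ) (n : ℕ) (S : (Option ρ → ℤ) → Prop) :
    ((box (Option ρ) n).filter fun x => S x ∧ pattern (x ∘ some) = pattern v₀).card ≤
      (2 * n + 1) ^ ((absValues v₀).card + 1) := by
  rw [card_pattern_class_eq, ← Fintype.card_coe (absValues v₀), ← Fintype.card_option, ← card_box]
  exact Finset.card_filter_le _ _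

theorem IsPoly.pattern_class {Q : ℕ → (Option ρ → ℤ) → Prop} (hQ : IsPoly Q) (v₀ : ρ → ℤ) :
    IsPoly fun n y => Q n (extend v₀ y) ∧ pattern (extend v₀ y ∘ some) = pattern v₀ := by
  have hext (o) : IsAffine fun _ y => extend v₀ y o := by
    rcases o with _ | q
    · exact IsAffine.coord none
    · refine .const_mul _ ?_
      split_ifs
      · exact IsAffine.coord _
      · exact IsAffine.const 0
  refine (hQ.comp hext).and ?_
  simp only [pattern_eq_iff_sign_mul]
  refine (IsPoly.all fun q => .sign_eq (hext (some q)) _).and ?_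
  exact IsPoly.all fun q => IsPoly.all fun q' =>
    .le_iff ((hext (some q)).const_mul _) ((hext (some q')).const_mul _) _

/-- The normalization of moment sums with `k` random factors. -/
def normFactor (k n : ℕ) : ℂ := (n : ℂ)⁻¹ * (((Real.sqrt n : ℝ) : ℂ)⁻¹) ^ k

theorem norm_normFactor (k n : ℕ) : ‖normFactor k n‖ = ((n : ℝ) * Real.sqrt n ^ k)⁻¹ := by
  simp [normFactor, abs_of_nonneg, Real.sqrt_nonneg, mul_comm]

theorem normFactor_two_mul (k n : ℕ) : normFactor (2 * k) n = ((n : ℂ) ^ (k + 1))⁻¹ := by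
  rw [normFactor, pow_mul, inv_pow, ← Complex.ofReal_pow, Real.sq_sqrt n.cast_nonneg,
    Complex.ofReal_natCast, inv_pow, pow_succ', mul_inv]

open scoped Classical in
/-- The normalized sum of moments over the lattice points of `S` in the cube. -/
def momentSum (E : ℕ → (ρ → ℤ) → ℂ) (n : ℕ) (S : (Option ρ → ℤ) → Prop) : ℂ :=
  normFactor (Fintype.card ρ) n * ∑ x ∈ (box (Option ρ) n).filter S, E n (x ∘ some)

theorem momentSum_def (E : ℕ → (ρ → ℤ) → ℂ) (n : ℕ) (S : (Option ρ → ℤ) → Prop) [DecidablePred S] :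
    momentSum E n S =
      normFactor (Fintype.card ρ) n * ∑ x ∈ (box (Option ρ) n).filter S, E n (x ∘ some) := by
  rw [momentSum]
  congr!

theorem momentSum_eq_sum_pattern (E : ℕ → (ρ → ℤ) → ℂ) (n : ℕ) (S : (Option ρ → ℤ) → Prop) :
    open scoped Classical in momentSum E n S =
      ∑ τ, momentSum E n fun x => S x ∧ pattern (x ∘ some) = τ := by
  classical
  simp only [momentSum_def, ← Finset.mul_sum, ← Finset.filter_filter]
  rw [Finset.sum_fiberwise]

namespace IsMomentFunction

variable {E : ℕ → (ρ → ℤ) → ℂ} (hE : IsMomentFunction E)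
include hE

theorem momentSum_class_eq_zero {τ : (ρ → SignType) × (ρ → ρ → Prop)}
    (hτ : ∀ v, pattern v = τ → ¬ Partnered v) {n : ℕ} (hn : 1 ≤ n) (S : (Option ρ → ℤ) → Prop) :
    momentSum E n (fun x => S x ∧ pattern (x ∘ some) = τ) = 0 := by
  classical
  rw [momentSum_def, Finset.sum_eq_zero, mul_zero]
  exact fun x hx => hE.eq_zero n hn _ (hτ _ (Finset.mem_filter.1 hx).2.2)

theorem norm_momentSum_class_le (v₀ : ρ → ℤ) : ∃ K, ∀ n, 1 ≤ n → ∀ S : (Option ρ → ℤ) → Prop,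
    ‖momentSum E n fun x => S x ∧ pattern (x ∘ some) = pattern v₀‖ ≤
      K * (Real.sqrt n ^ (2 * (absValues v₀).card) / Real.sqrt n ^ Fintype.card ρ) := by
  classical
  obtain ⟨M, hM⟩ := hE.bounded
  have hM0 : 0 ≤ M := (norm_nonneg _).trans (hM 1 le_rfl 0)
  set k := (absValues v₀).card
  refine ⟨3 ^ (k + 1) * M, fun n hn S => ?_⟩
  have hn0 : (n : ℝ) ≠ 0 := by positivity
  set s := (box (Option ρ) n).filter fun x => S x ∧ pattern (x ∘ some) = pattern v₀
  have hsum : ‖∑ x ∈ s, E n (x ∘ some)‖ ≤ 3 ^ (k + 1) * (n : ℝ) ^ (k + 1) * M :=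
    calc _ ≤ s.card * M := by
          simpa using norm_sum_le_of_le s fun x _ => hM n hn (x ∘ some)
      _ ≤ ((2 * n + 1 : ℕ) : ℝ) ^ (k + 1) * M := by
          gcongr; exact mod_cast card_pattern_class_le v₀ n S
      _ ≤ _ := by gcongr; exact two_mul_add_one_pow_le hn _
  rw [momentSum_def, norm_mul, norm_normFactor]
  calc _ ≤ ((n : ℝ) * Real.sqrt n ^ Fintype.card ρ)⁻¹ * (3 ^ (k + 1) * (n : ℝ) ^ (k + 1) * M) := by
        gcongr
    _ = _ := by
        rw [pow_mul (Real.sqrt n), Real.sq_sqrt n.cast_nonneg]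
        field_simp
        ring

theorem exists_bound_class (τ : (ρ → SignType) × (ρ → ρ → Prop)) : ∃ K : ℝ, ∀ n, 1 ≤ n →
    ∀ S : (Option ρ → ℤ) → Prop,
      ‖momentSum E n fun x => S x ∧ pattern (x ∘ some) = τ‖ ≤ K := by
  by_cases hτ : ∃ v₀, pattern v₀ = τ ∧ Partnered v₀
  · obtain ⟨v₀, rfl, hp⟩ := hτ
    obtain ⟨K, hK⟩ := hE.norm_momentSum_class_le v₀
    have hK0 : 0 ≤ K := by simpa using (norm_nonneg _).trans (hK 1 le_rfl fun _ => True)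
    refine ⟨K, fun n hn S => (hK n hn S).trans (mul_le_of_le_one_right hK0 ?_)⟩
    have hsqrt : 1 ≤ Real.sqrt n := Real.one_le_sqrt.2 (mod_cast hn)
    exact div_le_one_of_le₀ (pow_le_pow_right₀ hsqrt hp.two_mul_card_le) (by positivity)
  · push Not at hτ
    exact ⟨0, fun n hn S => by rw [hE.momentSum_class_eq_zero hτ hn, norm_zero]⟩

theorem exists_bound : ∃ K : ℝ, ∀ n, 1 ≤ n → ∀ S, ‖momentSum E n S‖ ≤ K := by
  classical
  choose K hK using hE.exists_bound_class
  refine ⟨∑ τ, K τ, fun n hn S => ?_⟩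
  rw [momentSum_eq_sum_pattern]
  exact norm_sum_le_of_le _ fun τ _ => hK τ n hn S

theorem tendsto_momentSum_class_of_lt {v₀ : ρ → ℤ}
    (hv₀ : 2 * (absValues v₀).card < Fintype.card ρ) (Q : ℕ → (Option ρ → ℤ) → Prop) :
    Tendsto (fun n => momentSum E n fun x => Q n x ∧ pattern (x ∘ some) = pattern v₀)
      atTop (𝓝 0) := by
  obtain ⟨K, hK⟩ := hE.norm_momentSum_class_le v₀
  have hlim := ((tendsto_pow_div_pow_atTop_zero (𝕜 := ℝ) hv₀).comp
    (Real.tendsto_sqrt_atTop.comp tendsto_natCast_atTop_atTop)).const_mul K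
  rw [mul_zero] at hlim
  refine squeeze_zero_norm' ?_ hlim
  filter_upwards [eventually_ge_atTop 1] with n hn using hK n hn _

theorem tendsto_momentSum_class_of_generic {v₀ : ρ → ℤ} (hv₀ : Generic v₀)
    (hcard : 2 * (absValues v₀).card = Fintype.card ρ) {Q : ℕ → (Option ρ → ℤ) → Prop}
    (hQ : IsPoly Q) :
    ∃ L : ℂ, Tendsto (fun n => momentSum E n fun x => Q n x ∧ pattern (x ∘ some) = pattern v₀)
      atTop (𝓝 L) := by
  classical
  obtain ⟨L, hL⟩ := (hQ.pattern_class v₀).exists_tendsto_card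
  refine ⟨L * E 1 v₀, (((Complex.continuous_ofReal.tendsto L).comp hL).mul_const _).congr' ?_⟩
  filter_upwards [eventually_ge_atTop 1] with n hn
  have hconst : ∀ x ∈ (box (Option ρ) n).filter fun x =>
      Q n x ∧ pattern (x ∘ some) = pattern v₀, E n (x ∘ some) = E 1 v₀ := fun x hx =>
    (hE.generic 1 n le_rfl hn _ _ (Finset.mem_filter.1 hx).2.2.symm hv₀).symm
  rw [momentSum_def, Finset.sum_congr rfl hconst, Finset.sum_const, nsmul_eq_mul,
    card_pattern_class_eq, ← hcard, normFactor_two_mul, Function.comp_apply, Fintype.card_option,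
    Fintype.card_coe, ← mul_assoc, inv_mul_eq_div]
  push_cast
  congr!

theorem tendsto_momentSum_class {Q : ℕ → (Option ρ → ℤ) → Prop} (hQ : IsPoly Q)
    (τ : (ρ → SignType) × (ρ → ρ → Prop)) :
    ∃ L : ℂ, Tendsto (fun n => momentSum E n fun x => Q n x ∧ pattern (x ∘ some) = τ)
      atTop (𝓝 L) := by
  by_cases hτ : ∃ v₀, pattern v₀ = τ ∧ Partnered v₀
  · obtain ⟨v₀, rfl, hp⟩ := hτ
    rcases hp.two_mul_card_le.lt_or_eq with hlt | heq
    · exact ⟨0, hE.tendsto_momentSum_class_of_lt hlt Q⟩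
    · exact hE.tendsto_momentSum_class_of_generic (hp.generic heq) heq hQ
  · push Not at hτ
    refine ⟨0, tendsto_const_nhds.congr' ?_⟩
    filter_upwards [eventually_ge_atTop 1] with n hn
    exact (hE.momentSum_class_eq_zero hτ hn _).symm

theorem tendsto_momentSum {Q : ℕ → (Option ρ → ℤ) → Prop} (hQ : IsPoly Q) :
    ∃ L : ℂ, Tendsto (fun n => momentSum E n (Q n)) atTop (𝓝 L) := by
  classical
  choose L hL using hE.tendsto_momentSum_class hQ
  refine ⟨∑ τ, L τ, ?_⟩
  simp only [momentSum_eq_sum_pattern E _ (Q _)]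
  exact tendsto_finsetSum _ fun τ _ => hL τ

end IsMomentFunction

end PatternSums

section Moments

variable {Ω : Type*} [MeasurableSpace Ω] {μ : Measure Ω}

/-- A complex random variable with finite moments of all orders. -/
def HasMoments (μ : Measure Ω) (f : Ω → ℂ) : Prop := ∀ p : ℕ, MemLp f (p : ENNReal) μ

namespace HasMoments

variable {f g : Ω → ℂ}

theorem const [IsFiniteMeasure μ] (c : ℂ) : HasMoments μ fun _ => c := fun _ => memLp_const c

theorem star (hf : HasMoments μ f) : HasMoments μ fun ω => star (f ω) := fun p => (hf p).star

theorem mul (hf : HasMoments μ f) (hg : HasMoments μ g) : HasMoments μ fun ω => f ω * g ω := by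
  intro p
  have : ENNReal.HolderTriple ((2 * p : ℕ) : ENNReal) ((2 * p : ℕ) : ENNReal) (p : ENNReal) := by
    refine ⟨?_⟩
    push_cast
    rw [ENNReal.mul_inv (by simp) (by simp), ← add_mul, ENNReal.inv_two_add_inv_two, one_mul]
  exact MemLp.mul' (hg (2 * p)) (hf (2 * p))

theorem sum {κ : Type*} (s : Finset κ) {f : κ → Ω → ℂ} (hf : ∀ k ∈ s, HasMoments μ (f k)) :
    HasMoments μ fun ω => ∑ k ∈ s, f k ω :=
  fun p => memLp_finsetSum s fun k hk => hf k hk p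

theorem prod [IsFiniteMeasure μ] {κ : Type*} (s : Finset κ) {f : κ → Ω → ℂ}
    (hf : ∀ k ∈ s, HasMoments μ (f k)) : HasMoments μ fun ω => ∏ k ∈ s, f k ω := by
  classical
  induction s using Finset.induction_on with
  | empty => simpa using const (μ := μ) 1
  | insert k s hk ih =>
    simp only [Finset.prod_insert hk]
    exact (hf k (Finset.mem_insert_self _ _)).mul
      (ih fun i hi => hf i (Finset.mem_insert_of_mem hi))

theorem integrable (hf : HasMoments μ f) : Integrable f μ :=
  memLp_one_iff_integrable.1 (by simpa using hf 1)

end HasMoments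

theorem memLp_of_integrable_abs_pow {f : Ω → ℝ} (hf : AEStronglyMeasurable f μ)
    (h : ∀ k : ℕ, 1 ≤ k → Integrable (fun ω => |f ω| ^ k) μ) (p : ℕ) :
    MemLp f (p : ENNReal) μ := by
  rcases Nat.eq_zero_or_pos p with rfl | hp
  · rwa [Nat.cast_zero, memLp_zero_iff_aestronglyMeasurable]
  · rw [← integrable_norm_rpow_iff hf (by simpa using hp.ne') (by simp)]
    simpa using h p hp

/-- Complex conjugation if `c` is set, and the identity otherwise. -/
def conjIf (c : Bool) : ℂ →+* ℂ := if c then starRingEnd ℂ else RingHom.id ℂ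

theorem norm_conjIf (c : Bool) (z : ℂ) : ‖conjIf c z‖ = ‖z‖ := by
  cases c <;> simp [conjIf]

theorem measurable_conjIf (c : Bool) : Measurable (conjIf c) := by
  cases c
  · exact measurable_id
  · exact Complex.continuous_conj.measurable

theorem conjIf_eq_re_add (c : Bool) (z : ℂ) : conjIf c z = z.re + conjIf c Complex.I * z.im := by
  cases c
  · simp [conjIf, mul_comm Complex.I]
  · apply Complex.ext <;> simp [conjIf]

theorem HasMoments.conjIf {f : Ω → ℂ} (hf : HasMoments μ f) (c : Bool) :
    HasMoments μ fun ω => conjIf c (f ω) := by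
  cases c
  · exact hf
  · exact hf.star

theorem integral_conjIf (c : Bool) (f : Ω → ℂ) :
    ∫ ω, conjIf c (f ω) ∂μ = conjIf c (∫ ω, f ω ∂μ) := by
  cases c
  · rfl
  · exact integral_conj

theorem integral_conjIf_mul_conjIf {f g : Ω → ℂ} (hf : MemLp f 2 μ) (hg : MemLp g 2 μ)
    (c c' : Bool) : ∫ ω, conjIf c (f ω) * conjIf c' (g ω) ∂μ =
      ((∫ ω, (f ω).re * (g ω).re ∂μ : ℝ) : ℂ) +
      conjIf c' Complex.I * (∫ ω, (f ω).re * (g ω).im ∂μ : ℝ) +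
      conjIf c Complex.I * (∫ ω, (f ω).im * (g ω).re ∂μ : ℝ) +
      conjIf c Complex.I * conjIf c' Complex.I * (∫ ω, (f ω).im * (g ω).im ∂μ : ℝ) := by
  have hrr : Integrable (fun ω => (((f ω).re * (g ω).re : ℝ) : ℂ)) μ :=
    (hf.re.integrable_mul hg.re).ofReal
  have hri : Integrable (fun ω => (((f ω).re * (g ω).im : ℝ) : ℂ)) μ :=
    (hf.re.integrable_mul hg.im).ofReal
  have hir : Integrable (fun ω => (((f ω).im * (g ω).re : ℝ) : ℂ)) μ :=
    (hf.im.integrable_mul hg.re).ofReal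
  have hii : Integrable (fun ω => (((f ω).im * (g ω).im : ℝ) : ℂ)) μ :=
    (hf.im.integrable_mul hg.im).ofReal
  simp only [← integral_complex_ofReal, ← integral_const_mul]
  rw [← integral_add, ← integral_add, ← integral_add]
  · congr 1
    funext ω
    rw [conjIf_eq_re_add c, conjIf_eq_re_add c']
    push_cast
    ring
  exacts [(hrr.add (hri.const_mul _)).add (hir.const_mul _), hii.const_mul _,
    hrr.add (hri.const_mul _), hir.const_mul _, hrr, hri.const_mul _]

namespace IsPairCorrelated

variable {a : ℕ → ℤ → Ω → ℂ} {q : CorrParams} (ha : IsPairCorrelated μ a q)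
include ha

theorem hasMoments {n : ℕ} (hn : 1 ≤ n) (j : ℤ) : HasMoments μ (a n j) := by
  intro p
  obtain ⟨c, hc⟩ := ha.moments
  have hm := ha.measurable n hn j
  exact memLp_re_im_iff.1
    ⟨memLp_of_integrable_abs_pow (by fun_prop) (fun k hk => (hc k hk n hn j).1) p,
      memLp_of_integrable_abs_pow (by fun_prop) (fun k hk => (hc k hk n hn j).2.2.1) p⟩

theorem integrable_norm_pow {n : ℕ} (hn : 1 ≤ n) (j : ℤ) {k : ℕ} (hk : 1 ≤ k) :
    Integrable (fun ω => ‖a n j ω‖ ^ k) μ :=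
  (ha.hasMoments hn j k).integrable_norm_pow (Nat.one_le_iff_ne_zero.1 hk)

theorem exists_moment_bound {k : ℕ} (hk : 1 ≤ k) :
    ∃ C : ℝ, ∀ n, 1 ≤ n → ∀ j, ∫ ω, ‖a n j ω‖ ^ k ∂μ ≤ C := by
  obtain ⟨c, hc⟩ := ha.moments
  refine ⟨2 ^ (k - 1) * (c k + c k), fun n hn j => ?_⟩
  obtain ⟨hint_re, hre, hint_im, him⟩ := hc k hk n hn j
  have hle ω : ‖a n j ω‖ ^ k ≤ 2 ^ (k - 1) * (|(a n j ω).re| ^ k + |(a n j ω).im| ^ k) :=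
    (pow_le_pow_left₀ (norm_nonneg _) (Complex.norm_le_abs_re_add_abs_im _) k).trans
      (add_pow_le (abs_nonneg _) (abs_nonneg _) k)
  calc ∫ ω, ‖a n j ω‖ ^ k ∂μ
    _ ≤ ∫ ω, 2 ^ (k - 1) * (|(a n j ω).re| ^ k + |(a n j ω).im| ^ k) ∂μ :=
      integral_mono (ha.integrable_norm_pow hn j hk) ((hint_re.add hint_im).const_mul _) hle
    _ ≤ 2 ^ (k - 1) * (c k + c k) := by
      rw [integral_const_mul, integral_add hint_re hint_im]
      gcongr

theorem exists_covariances {s s' : SignType} (hs : s ≠ 0) (hs' : s' ≠ 0) :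
    ∃ A B C D : ℝ, ∀ n, 1 ≤ n → ∀ j : ℤ, 1 ≤ j →
      ∫ ω, (a n (s * j) ω).re * (a n (s' * j) ω).re ∂μ = A ∧
      ∫ ω, (a n (s * j) ω).re * (a n (s' * j) ω).im ∂μ = B ∧
      ∫ ω, (a n (s * j) ω).im * (a n (s' * j) ω).re ∂μ = C ∧
      ∫ ω, (a n (s * j) ω).im * (a n (s' * j) ω).im ∂μ = D := by
  have him_re (n : ℕ) (i j : ℤ) : ∫ ω, (a n i ω).im * (a n j ω).re ∂μ =
      ∫ ω, (a n j ω).re * (a n i ω).im ∂μ := by simp only [mul_comm]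
  rcases s.trichotomy with rfl | rfl | rfl <;> rcases s'.trichotomy with rfl | rfl | rfl
  any_goals contradiction
  · refine ⟨q.sigmaX ^ 2, q.rho6, q.rho6, q.sigmaY ^ 2, fun n hn j hj => ?_⟩
    simp only [SignType.coe_neg_one, neg_one_mul, him_re, ← sq]
    exact ⟨ha.sq_x n hn _, ha.corr6 n hn j hj, ha.corr6 n hn j hj, ha.sq_y n hn _⟩
  · refine ⟨q.rho2, q.rho4, q.rho3, q.rho5, fun n hn j hj => ?_⟩
    simp only [SignType.coe_neg_one, SignType.coe_one, neg_one_mul, one_mul, him_re]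
    simp only [mul_comm (a n (-j) _).re (a n j _).re, mul_comm (a n (-j) _).im (a n j _).im]
    exact ⟨ha.corr2 n hn j hj, ha.corr4 n hn j hj, ha.corr3 n hn j hj, ha.corr5 n hn j hj⟩
  · refine ⟨q.rho2, q.rho3, q.rho4, q.rho5, fun n hn j hj => ?_⟩
    simp only [SignType.coe_neg_one, SignType.coe_one, neg_one_mul, one_mul, him_re]
    exact ⟨ha.corr2 n hn j hj, ha.corr3 n hn j hj, ha.corr4 n hn j hj, ha.corr5 n hn j hj⟩
  · refine ⟨q.sigmaX ^ 2, q.rho1, q.rho1, q.sigmaY ^ 2, fun n hn j hj => ?_⟩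
    simp only [SignType.coe_one, one_mul, him_re, ← sq]
    exact ⟨ha.sq_x n hn _, ha.corr1 n hn j hj, ha.corr1 n hn j hj, ha.sq_y n hn _⟩

theorem exists_integral_conjIf_mul_conjIf_eq {s s' : SignType} (hs : s ≠ 0) (hs' : s' ≠ 0)
    (c c' : Bool) : ∃ C : ℂ, ∀ n, 1 ≤ n → ∀ j : ℤ, 1 ≤ j →
      ∫ ω, conjIf c (a n (s * j) ω) * conjIf c' (a n (s' * j) ω) ∂μ = C := by
  obtain ⟨A, B, C, D, h⟩ := ha.exists_covariances hs hs'
  refine ⟨A + conjIf c' Complex.I * B + conjIf c Complex.I * C +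
    conjIf c Complex.I * conjIf c' Complex.I * D, fun n hn j hj => ?_⟩
  obtain ⟨hA, hB, hC, hD⟩ := h n hn j hj
  rw [integral_conjIf_mul_conjIf (ha.hasMoments hn _ 2) (ha.hasMoments hn _ 2), hA, hB, hC, hD]

theorem integral_conjIf_mul_conjIf_congr {n n' : ℕ} (hn : 1 ≤ n) (hn' : 1 ≤ n') {v w v' w' : ℤ}
    (h : |v| = |w|) (h' : |v'| = |w'|) (hv : v ≠ 0)
    (hsign : SignType.sign v = SignType.sign v') (hsign' : SignType.sign w = SignType.sign w')
    (c c' : Bool) :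
    ∫ ω, conjIf c (a n v ω) * conjIf c' (a n w ω) ∂μ =
      ∫ ω, conjIf c (a n' v' ω) * conjIf c' (a n' w' ω) ∂μ := by
  have hw : w ≠ 0 := abs_ne_zero.1 (h ▸ abs_ne_zero.2 hv)
  have hv' : v' ≠ 0 := sign_ne_zero.1 (hsign ▸ sign_ne_zero.2 hv)
  obtain ⟨C, hC⟩ := ha.exists_integral_conjIf_mul_conjIf_eq
    (sign_ne_zero.2 hv) (sign_ne_zero.2 hw) c c'
  have hj := hC n hn |v| (Int.one_le_abs hv)
  have hj' := hC n' hn' |v'| (Int.one_le_abs hv')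
  rw [sign_mul_abs, h, sign_mul_abs] at hj
  rw [hsign, sign_mul_abs, hsign', h', sign_mul_abs] at hj'
  rw [hj, hj']

end IsPairCorrelated

section Blocks

variable {ρ α : Type*} [Fintype ρ]

open scoped Classical in
/-- The partition of the indices according to the values of `key`. -/
def blocks (key : ρ → α) : Finset (Finset ρ) :=
  Finset.univ.image fun p => Finset.univ.filter fun p' => key p' = key p

theorem mem_blocks [DecidableEq α] {key : ρ → α} {B : Finset ρ} :
    B ∈ blocks key ↔ ∃ p, B = Finset.univ.filter fun p' => key p' = key p := by
  simp only [blocks, Finset.mem_image, Finset.mem_univ, true_and]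
  exact exists_congr fun p => by rw [eq_comm]; congr!

theorem blocks_congr {β : Type*} {key : ρ → α} {key' : ρ → β}
    (h : ∀ p p', key p = key p' ↔ key' p = key' p') : blocks key = blocks key' := by
  unfold blocks
  congr! 4
  exact h _ _

theorem Generic.block_eq_singleton_or_pair [DecidableEq ρ] {v : ρ → ℤ} (hv : Generic v) {k : ρ → α}
    {B : Finset ρ} (hB : B ∈ blocks fun p => (k p, |v p|)) :
    (∃ p, B = {p}) ∨ ∃ p p', p ≠ p' ∧ k p = k p' ∧ |v p| = |v p'| ∧ B = {p, p'} := by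
  classical
  obtain ⟨p, rfl⟩ := mem_blocks.1 hB
  set B := Finset.univ.filter fun p' => (k p', |v p'|) = (k p, |v p|)
  have hmem {p'} (h : p' ∈ B) : k p' = k p ∧ |v p'| = |v p| :=
    Prod.mk.inj (Finset.mem_filter.1 h).2
  have hle : B.card ≤ 2 := (hv p).2 ▸
    Finset.card_le_card fun p' h => Finset.mem_filter.2 ⟨Finset.mem_univ _, (hmem h).2⟩
  have hpos : 0 < B.card := Finset.card_pos.2 ⟨p, by simp [B]⟩
  obtain h | h : B.card = 1 ∨ B.card = 2 := by omega
  · exact Or.inl (Finset.card_eq_one.1 h)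
  · obtain ⟨p₁, p₂, hne, hB⟩ := Finset.card_eq_two.1 h
    obtain ⟨hk₁, hv₁⟩ := hmem (hB ▸ Finset.mem_insert_self p₁ {p₂})
    obtain ⟨hk₂, hv₂⟩ := hmem (hB ▸ Finset.mem_insert_of_mem (Finset.mem_singleton_self p₂))
    exact Or.inr ⟨p₁, p₂, hne, hk₁.trans hk₂.symm, hv₁.trans hv₂.symm, hB⟩

theorem integral_prod_eq_prod_blocks {β : Type*} [MeasurableSpace β]
    {Z : α → Ω → β} (hindep : iIndepFun Z μ) (hZ : ∀ i, AEMeasurable (Z i) μ) (key : ρ → α)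
    {g : ρ → β → ℂ} (hg : ∀ p, Measurable (g p)) :
    ∫ ω, ∏ p, g p (Z (key p) ω) ∂μ =
      ∏ B ∈ blocks key, ∫ ω, ∏ p ∈ B, g p (Z (key p) ω) ∂μ := by
  classical
  set K := Finset.univ.image key
  let X (i : K) (ω : Ω) : ℂ := ∏ p with key p = i, g p (Z i ω)
  have hX : iIndepFun X μ := (hindep.precomp (g := ((↑) : K → α)) Subtype.val_injective).comp
    (fun i z => ∏ p with key p = i, g p z) fun i => Finset.measurable_prod _ fun p _ => hg p
  have hX_eq (i : K) : X i = fun ω => ∏ p with key p = i, g p (Z (key p) ω) := funext fun ω =>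
    Finset.prod_congr rfl fun p hp => by rw [(Finset.mem_filter.1 hp).2]
  have hXm (i : K) : AEStronglyMeasurable (X i) μ :=
    (Finset.aemeasurable_fun_prod _ fun p _ => (hg p).comp_aemeasurable (hZ i)).aestronglyMeasurable
  have hblocks : blocks key = K.image fun i => Finset.univ.filter fun p => key p = i := by
    rw [blocks, Finset.image_image]
    congr!
  have hinj : Set.InjOn (fun i => Finset.univ.filter fun p => key p = i) K := by
    intro i hi j _ hij
    obtain ⟨p, -, rfl⟩ := Finset.mem_image.1 hi
    simpa using (Finset.ext_iff.1 hij p)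
  calc ∫ ω, ∏ p, g p (Z (key p) ω) ∂μ
    _ = ∫ ω, ∏ i : K, X i ω ∂μ := by
      congr 1
      funext ω
      rw [← Finset.prod_fiberwise_of_maps_to (t := K) fun p _ => Finset.mem_image_of_mem key
        (Finset.mem_univ p), ← Finset.prod_coe_sort]
      simp only [hX_eq]
    _ = ∏ i : K, ∫ ω, X i ω ∂μ := hX.integral_fun_prod_eq_prod_integral hXm
    _ = _ := by
      simp only [hX_eq]
      rw [hblocks, Finset.prod_image hinj]
      exact Finset.prod_coe_sort K fun i => ∫ ω, ∏ p with key p = i, g p (Z (key p) ω) ∂μ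

end Blocks

theorem prod_le_sum_pow_card {ρ : Type*} [Fintype ρ] [Nonempty ρ] {f : ρ → ℝ} (hf : ∀ p, 0 ≤ f p) :
    ∏ p, f p ≤ ∑ p, f p ^ Fintype.card ρ := by
  obtain ⟨p₀, hp₀⟩ := Finite.exists_max f
  calc ∏ p, f p ≤ ∏ _p : ρ, f p₀ := Finset.prod_le_prod (fun p _ => hf p) fun p _ => hp₀ p
    _ = f p₀ ^ Fintype.card ρ := by rw [Finset.prod_const, Finset.card_univ]
    _ ≤ ∑ p, f p ^ Fintype.card ρ :=
      Finset.single_le_sum (f := fun p => f p ^ Fintype.card ρ) (fun p _ => pow_nonneg (hf p) _)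
        (Finset.mem_univ p₀)

variable {κ : Type*} {u : κ → ℕ → ℤ → Ω → ℂ} {q : κ → CorrParams}

theorem iIndepFun_pairs (hu : ∀ k, IsPairCorrelated μ (u k) (q k)) {n : ℕ} (hn : 1 ≤ n)
    (hindep : iIndepFun (fun k ω (j : ℤ) => u k n j ω) μ) :
    iIndepFun (fun (x : κ × ℕ) ω => (u x.1 n (x.2 : ℤ) ω, u x.1 n (-(x.2 : ℤ)) ω)) μ := by
  refine iIndepFun_uncurry' (X := fun k (j : ℕ) ω => (u k n (j : ℤ) ω, u k n (-(j : ℤ)) ω))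
    (fun k j => ((hu k).measurable n hn _).prodMk ((hu k).measurable n hn _)) ?_
    fun k => (hu k).indep n hn
  exact hindep.comp (fun _ z (j : ℕ) => (z (j : ℤ), z (-(j : ℤ)))) fun _ => by fun_prop

variable {ρ : Type*}

/-- The coordinate with index `v` of the pair `(a |v|, a (-|v|))`. -/
def pairCoord (v : ℤ) (z : ℂ × ℂ) : ℂ := if 0 ≤ v then z.1 else z.2

theorem measurable_pairCoord (v : ℤ) : Measurable (pairCoord v) := by
  unfold pairCoord
  split_ifs <;> fun_prop

theorem pairCoord_natAbs {β : Type*} (a : ℤ → β → ℂ) (v : ℤ) (ω : β) :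
    pairCoord v (a v.natAbs ω, a (-v.natAbs) ω) = a v ω := by
  unfold pairCoord
  split_ifs with hv
  · rw [Int.natAbs_of_nonneg hv]
  · rw [Int.ofNat_natAbs_of_nonpos (not_le.1 hv).le, neg_neg]

/-- The factor of a joint moment that comes from the possibly conjugated input `l`. -/
def entry (u : κ → ℕ → ℤ → Ω → ℂ) (l : κ × Bool) (n : ℕ) (v : ℤ) (ω : Ω) : ℂ :=
  conjIf l.2 (u l.1 n v ω)

/-- The joint moment of the entries with indices `v`. -/
def jointMoment [Fintype ρ] (μ : Measure Ω) (u : κ → ℕ → ℤ → Ω → ℂ) (l : ρ → κ × Bool) (n : ℕ)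
    (v : ρ → ℤ) : ℂ :=
  ∫ ω, ∏ p, entry u (l p) n (v p) ω ∂μ

section

variable (hu : ∀ k, IsPairCorrelated μ (u k) (q k))
include hu

theorem hasMoments_entry {n : ℕ} (hn : 1 ≤ n) (l : κ × Bool) (v : ℤ) :
    HasMoments μ (entry u l n v) :=
  ((hu l.1).hasMoments hn v).conjIf l.2

theorem integral_entry {n : ℕ} (hn : 1 ≤ n) (l : κ × Bool) (v : ℤ) :
    ∫ ω, entry u l n v ω ∂μ = 0 := by
  simp only [entry, integral_conjIf, (hu l.1).mean_zero n hn, map_zero]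

variable [Fintype ρ]

theorem jointMoment_eq_prod_blocks {n : ℕ} (hn : 1 ≤ n)
    (hindep : iIndepFun (fun k ω (j : ℤ) => u k n j ω) μ) (l : ρ → κ × Bool) (v : ρ → ℤ) :
    jointMoment μ u l n v = ∏ B ∈ blocks fun p => ((l p).1, |v p|),
      ∫ ω, ∏ p ∈ B, entry u (l p) n (v p) ω ∂μ := by
  have hentry (p : ρ) (ω : Ω) : entry u (l p) n (v p) ω = (conjIf (l p).2 ∘ pairCoord (v p))
      (u (l p).1 n (v p).natAbs ω, u (l p).1 n (-(v p).natAbs) ω) := by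
    rw [Function.comp_apply, pairCoord_natAbs, entry]
  have hblocks : (blocks fun p => ((l p).1, |v p|)) = blocks fun p => ((l p).1, (v p).natAbs) :=
    blocks_congr fun p p' => by
      rw [Prod.mk.injEq, Prod.mk.injEq, abs_eq_abs, Int.natAbs_eq_natAbs_iff]
  simp only [jointMoment, hentry, hblocks]
  exact integral_prod_eq_prod_blocks (iIndepFun_pairs hu hn hindep)
    (fun x => (((hu x.1).measurable n hn _).prodMk ((hu x.1).measurable n hn _)).aemeasurable)
    (fun p => ((l p).1, (v p).natAbs)) fun p => (measurable_conjIf _).comp (measurable_pairCoord _)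

theorem exists_norm_jointMoment_le (l : ρ → κ × Bool) :
    ∃ K : ℝ, ∀ n, 1 ≤ n → ∀ v, ‖jointMoment μ u l n v‖ ≤ K := by
  rcases isEmpty_or_nonempty ρ with hρ | hρ
  · exact ⟨‖∫ _, (1 : ℂ) ∂μ‖, fun n _ v => by simp [jointMoment]⟩
  have hcard : 1 ≤ Fintype.card ρ := Fintype.card_pos
  choose C hC using fun k => (hu k).exists_moment_bound hcard
  refine ⟨∑ p, C (l p).1, fun n hn v => ?_⟩
  have hint (p : ρ) : Integrable (fun ω => ‖u (l p).1 n (v p) ω‖ ^ Fintype.card ρ) μ :=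
    (hu _).integrable_norm_pow hn _ hcard
  calc ‖jointMoment μ u l n v‖
    _ ≤ ∫ ω, ∑ p, ‖u (l p).1 n (v p) ω‖ ^ Fintype.card ρ ∂μ := by
      refine norm_integral_le_of_norm_le (integrable_finsetSum _ fun p _ => hint p)
        (ae_of_all _ fun ω => ?_)
      simp only [entry, norm_prod, norm_conjIf]
      exact prod_le_sum_pow_card fun p => norm_nonneg _
    _ ≤ ∑ p, C (l p).1 := by
      rw [integral_finsetSum _ fun p _ => hint p]
      exact Finset.sum_le_sum fun p _ => hC _ n hn _

variable (hindep : ∀ n, 1 ≤ n → iIndepFun (fun k ω (j : ℤ) => u k n j ω) μ)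
include hindep

theorem jointMoment_eq_zero (l : ρ → κ × Bool) {n : ℕ} (hn : 1 ≤ n) {v : ρ → ℤ}
    (hv : ¬Partnered v) : jointMoment μ u l n v = 0 := by
  classical
  obtain ⟨p, hp⟩ := not_forall.1 hv
  have hblock : {p} ∈ blocks fun p => ((l p).1, |v p|) := by
    refine mem_blocks.2 ⟨p, (Finset.eq_singleton_iff_unique_mem.2 ⟨by simp, fun p' hp' => ?_⟩).symm⟩
    rw [Finset.mem_filter, Prod.mk.injEq] at hp'
    exact Finset.card_le_one.1 (Nat.lt_succ_iff.1 (not_le.1 hp)) p' (by simp [hp'.2.2]) p (by simp)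
  rw [jointMoment_eq_prod_blocks hu hn (hindep n hn) l v]
  refine Finset.prod_eq_zero hblock ?_
  simp only [Finset.prod_singleton, integral_entry hu hn]

theorem jointMoment_congr (l : ρ → κ × Bool) {n n' : ℕ} (hn : 1 ≤ n) (hn' : 1 ≤ n')
    {v v' : ρ → ℤ} (h : pattern v = pattern v') (hv : Generic v) :
    jointMoment μ u l n v = jointMoment μ u l n' v' := by
  have hblocks : (blocks fun p => ((l p).1, |v p|)) = blocks fun p => ((l p).1, |v' p|) :=
    blocks_congr fun p p' => by rw [Prod.mk.injEq, Prod.mk.injEq, abs_eq_iff_of_pattern_eq h]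
  rw [jointMoment_eq_prod_blocks hu hn (hindep n hn),
    jointMoment_eq_prod_blocks hu hn' (hindep n' hn'), hblocks]
  refine Finset.prod_congr rfl fun B hB => ?_
  classical
  rcases hv.block_eq_singleton_or_pair (hblocks ▸ hB) with
    ⟨p, rfl⟩ | ⟨p, p', hne, hl, habs, rfl⟩
  · simp only [Finset.prod_singleton, integral_entry hu hn, integral_entry hu hn']
  · have hsign := (pattern_eq_iff.1 h).1
    simp only [Finset.prod_pair hne, entry, ← hl]
    exact (hu _).integral_conjIf_mul_conjIf_congr hn hn' habs
      ((abs_eq_iff_of_pattern_eq h p p').1 habs) (hv p).1 (hsign p) (hsign p') _ _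

theorem isMomentFunction_jointMoment (l : ρ → κ × Bool) :
    IsMomentFunction (jointMoment μ u l) where
  bounded := exists_norm_jointMoment_le hu l
  eq_zero _ hn _ hv := jointMoment_eq_zero hu hindep l hn hv
  generic _ _ hn hn' _ _ h hv := jointMoment_congr hu hindep l hn hn' h hv

end

end Moments

section Paths

/-- The matrix of the step `i ↦ f i`, killed where the step leaves `{0, …, n - 1}`. -/
def stepMatrix (n : ℕ) (f : ℤ → ℤ) : Matrix (Fin n) (Fin n) ℂ :=
  Matrix.of fun i j => if f (i : ℕ) = (j : ℕ) then 1 else 0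

/-- The successive steps in the list lead from `i` to `j` and never leave `{0, …, n - 1}`. -/
def IsPath (n : ℕ) : List (ℤ → ℤ) → ℤ → ℤ → Prop
  | [], i, j => (0 ≤ i ∧ i < n) ∧ i = j
  | f :: l, i, j => (0 ≤ i ∧ i < n) ∧ IsPath n l (f i) j

theorem IsPath.mem {n : ℕ} {l : List (ℤ → ℤ)} {i j : ℤ} (h : IsPath n l i j) : 0 ≤ i ∧ i < n := by
  cases l <;> exact h.1

theorem exists_val_eq {n : ℕ} {i : ℤ} (hi : 0 ≤ i ∧ i < n) : ∃ k : Fin n, ((k : ℕ) : ℤ) = i :=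
  ⟨⟨i.toNat, by omega⟩, Int.toNat_of_nonneg hi.1⟩

open scoped Classical in
theorem prod_stepMatrix_apply {n : ℕ} (l : List (ℤ → ℤ)) (i j : Fin n) :
    (l.map (stepMatrix n)).prod i j = if IsPath n l (i : ℕ) (j : ℕ) then 1 else 0 := by
  induction l generalizing i with
  | nil => simp [IsPath, Matrix.one_apply, Fin.ext_iff]
  | cons f l ih =>
    have hi : 0 ≤ ((i : ℕ) : ℤ) ∧ ((i : ℕ) : ℤ) < n := by omega
    simp only [List.map_cons, List.prod_cons, Matrix.mul_apply, ih, IsPath, hi, true_and]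
    by_cases hf : 0 ≤ f (i : ℕ) ∧ f (i : ℕ) < n
    · obtain ⟨x, hx⟩ := exists_val_eq hf
      simp only [stepMatrix, Matrix.of_apply, ← hx, Nat.cast_inj, ← Fin.ext_iff, ite_mul, one_mul,
        zero_mul, Finset.sum_ite_eq, Finset.mem_univ, if_true]
    · rw [if_neg fun h => hf h.mem]
      refine Finset.sum_eq_zero fun x _ => ?_
      rw [stepMatrix, Matrix.of_apply, if_neg (by omega), zero_mul]

open scoped Classical in
theorem trace_prod_stepMatrix {n : ℕ} (l : List (ℤ → ℤ)) :
    (l.map (stepMatrix n)).prod.trace =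
      ∑ i ∈ Finset.Icc (-(n : ℤ)) n, if IsPath n l i i then 1 else 0 := by
  have hinj : Function.Injective fun k : Fin n => ((k : ℕ) : ℤ) :=
    Nat.cast_injective.comp Fin.val_injective
  simp only [Matrix.trace, Matrix.diag_apply, prod_stepMatrix_apply]
  refine (Finset.sum_map Finset.univ ⟨_, hinj⟩
    fun i => if IsPath n l i i then (1 : ℂ) else 0).symm.trans ?_
  refine Finset.sum_subset (fun i hi => ?_) fun i _ hi => if_neg fun h => hi ?_
  · obtain ⟨k, -, rfl⟩ := Finset.mem_map.1 hi
    simp only [Function.Embedding.coeFn_mk, Finset.mem_Icc]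
    omega
  · obtain ⟨k, rfl⟩ := exists_val_eq h.mem
    exact Finset.mem_map.2 ⟨k, Finset.mem_univ k, rfl⟩

theorem isPoly_isPath {ι : Type*} [Fintype ι] (l : List (ℕ → (ι → ℤ) → ℤ → ℤ))
    (hl : ∀ g ∈ l, ∀ f : ℕ → (ι → ℤ) → ℤ, IsAffine f → IsAffine fun n x => g n x (f n x))
    {f f' : ℕ → (ι → ℤ) → ℤ} (hf : IsAffine f) (hf' : IsAffine f') :
    IsPoly fun n x => IsPath n (l.map fun g => g n x) (f n x) (f' n x) := by
  have hmem {f : ℕ → (ι → ℤ) → ℤ} (hf : IsAffine f) :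
      IsPoly fun n x => 0 ≤ f n x ∧ f n x < (n : ℤ) :=
    (IsPoly.le (IsAffine.const 0) hf).and (IsPoly.lt hf IsAffine.scale)
  induction l generalizing f with
  | nil => exact (hmem hf).and (IsPoly.eq hf hf')
  | cons g l ih =>
    exact (hmem hf).and (ih (fun g hg => hl g (List.mem_cons_of_mem _ hg))
      (hl g List.mem_cons_self f hf))

theorem prod_ofFn_sum_smul {R : Type*} [Ring R] [Algebra ℂ R] {k n : ℕ} (c : Fin k → ℤ → ℂ)
    (M : Fin k → ℤ → R) :
    (List.ofFn fun p => ∑ v ∈ Finset.Icc (-(n : ℤ)) n, c p v • M p v).prod =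
      ∑ v ∈ box (Fin k) n, (∏ p, c p (v p)) • (List.ofFn fun p => M p (v p)).prod := by
  simp only [← MultilinearMap.mkPiAlgebraFin_apply (R := ℂ), ← MultilinearMap.map_smul_univ]
  rw [MultilinearMap.map_sum_finset, box]
  congr!

theorem eq_sum_smul_stepMatrix {n : ℕ} {M : Matrix (Fin n) (Fin n) ℂ} {c : ℤ → ℂ} {f g : ℤ → ℤ → ℤ}
    (hM : ∀ i j : Fin n, M i j = c (g (i : ℕ) (j : ℕ)))
    (hg : ∀ i j : Fin n, g (i : ℕ) (j : ℕ) ∈ Finset.Icc (-(n : ℤ)) n)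
    (hf : ∀ v i j, f v i = j ↔ v = g i j) :
    M = ∑ v ∈ Finset.Icc (-(n : ℤ)) n, c v • stepMatrix n (f v) := by
  ext i j
  simp [Matrix.sum_apply, stepMatrix, hM, hf, hg]

end Paths

section Factors

variable {Ω κ : Type*}

/-- The ingredients of a letter of a word in the collection: a random or deterministic input, and
whether the letter is a Hankel matrix and whether it carries an adjoint. -/
structure Factor (κ : Type*) where
  input : κ ⊕ (ℤ → ℂ)
  hankel : Bool
  adjoint : Bool

namespace Factor

/-- The matrix of a factor; random inputs are scaled by `n ^ (-1 / 2)`. -/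
def matrix (u : κ → ℕ → ℤ → Ω → ℂ) (n : ℕ) (ω : Ω) (F : Factor κ) : Matrix (Fin n) (Fin n) ℂ :=
  let c : ℤ → ℂ := F.input.elim (fun k v => ((Real.sqrt n : ℝ) : ℂ)⁻¹ * u k n v ω) id
  let M := if F.hankel then symmHankel c n else toeplitz c n
  if F.adjoint then star M else M

/-- The coefficient of the partial permutation of index `v` in the matrix of a factor. -/
def coef (u : κ → ℕ → ℤ → Ω → ℂ) (n : ℕ) (ω : Ω) (F : Factor κ) (v : ℤ) : ℂ :=
  F.input.elim (fun k => ((Real.sqrt n : ℝ) : ℂ)⁻¹ * entry u (k, F.adjoint) n v ω)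
    fun c => conjIf F.adjoint (c v)

/-- The partial permutation of `{0, …, n - 1}` with index `v` in the matrix of a factor. -/
def step (F : Factor κ) (n : ℕ) (v i : ℤ) : ℤ :=
  if F.hankel then n - 1 - i - v else if F.adjoint then i + v else i - v

end Factor

theorem symmHankel_apply (c : ℤ → ℂ) {n : ℕ} (i j : Fin n) :
    symmHankel c n i j = c ((n : ℤ) - 1 - (i : ℕ) - (j : ℕ)) := by
  have hrev (x : Fin n) : backwardIdentity n i x = if Fin.rev i = x then 1 else 0 := by
    simp only [backwardIdentity, Matrix.of_apply, Fin.ext_iff, Fin.val_rev]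
    congr 1
    exact propext (by omega)
  simp only [symmHankel, Matrix.mul_apply, hrev, ite_mul, one_mul, zero_mul, Finset.sum_ite_eq,
    Finset.mem_univ, if_true, toeplitz, Matrix.of_apply, Fin.val_rev]
  congr 1
  omega

namespace Factor

theorem matrix_eq_sum (u : κ → ℕ → ℤ → Ω → ℂ) (n : ℕ) (ω : Ω) (F : Factor κ) :
    F.matrix u n ω =
      ∑ v ∈ Finset.Icc (-(n : ℤ)) n, F.coef u n ω v • stepMatrix n (F.step n v) := by
  obtain ⟨c, hankel, adjoint⟩ := F
  refine eq_sum_smul_stepMatrix (g := fun i j => if hankel then n - 1 - i - j else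
    if adjoint then j - i else i - j) (fun i j => ?_) (fun i j => ?_) fun v i j => ?_
  · rcases c with k | c <;> cases hankel <;> cases adjoint <;>
      simp [matrix, coef, entry, conjIf, toeplitz, symmHankel_apply, sub_right_comm]
  · rw [Finset.mem_Icc]
    split_ifs <;> omega
  · simp only [step]
    split_ifs <;> omega

end Factor

/-- The factor of a letter of the collection, with an adjoint if `b` is set. The backward identity
is the symmetric Hankel matrix with input `δ₀`. -/
def Label.factor {m : ℕ} (t h : Fin m → κ) (d e : Fin m → ℤ → ℂ) (b : Bool) : Label m → Factor κ
  | .randToeplitz i => ⟨.inl (t i), false, b⟩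
  | .randHankel i => ⟨.inl (h i), true, b⟩
  | .detToeplitz i => ⟨.inr (d i), false, b⟩
  | .detHankel i => ⟨.inr (e i), true, b⟩
  | .backward => ⟨.inr (Pi.single 0 1), true, b⟩

theorem matrix_factor (u : κ → ℕ → ℤ → Ω → ℂ) {m : ℕ} (t h : Fin m → κ) (d e : Fin m → ℤ → ℂ)
    (l : Label m × Bool) (n : ℕ) (ω : Ω) : (l.1.factor t h d e l.2).matrix u n ω =
      if l.2 then star (collection (fun i => u (t i)) (fun i => u (h i)) d e l.1 n ω)
      else collection (fun i => u (t i)) (fun i => u (h i)) d e l.1 n ω := by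
  obtain ⟨l, b⟩ := l
  have hmatrix : (l.factor t h d e false).matrix u n ω =
      collection (fun i => u (t i)) (fun i => u (h i)) d e l n ω := by
    ext i j
    cases l <;> simp only [Label.factor, Factor.matrix, collection, Matrix.smul_apply,
      symmHankel_apply, Bool.false_eq_true, if_true, if_false, Sum.elim_inl, Sum.elim_inr, id,
      smul_eq_mul, toeplitz, Matrix.of_apply, backwardIdentity, Pi.single_apply]
    congr 1
    exact propext (by omega)
  rw [← hmatrix]
  cases l <;> cases b <;> rfl

theorem starWord_collection (u : κ → ℕ → ℤ → Ω → ℂ) {m : ℕ} (t h : Fin m → κ)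
    (d e : Fin m → ℤ → ℂ) (w : List (Label m × Bool)) (n : ℕ) (ω : Ω) :
    starWord (fun l => collection (fun i => u (t i)) (fun i => u (h i)) d e l n ω) w =
      ((w.map fun l => l.1.factor t h d e l.2).map (Factor.matrix u n ω)).prod := by
  simp only [starWord, List.map_map, Function.comp_def, matrix_factor]

open scoped Classical in
theorem trace_prod_matrix (u : κ → ℕ → ℤ → Ω → ℂ) {k : ℕ} (F : Fin k → Factor κ) (n : ℕ) (ω : Ω) :
    (List.ofFn fun p => (F p).matrix u n ω).prod.trace =
      ∑ v ∈ box (Fin k) n, (∏ p, (F p).coef u n ω (v p)) *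
        ∑ i ∈ Finset.Icc (-(n : ℤ)) n,
          if IsPath n (List.ofFn fun p => (F p).step n (v p)) i i then 1 else 0 := by
  simp only [Factor.matrix_eq_sum, prod_ofFn_sum_smul, Matrix.trace_sum, Matrix.trace_smul,
    smul_eq_mul, ← trace_prod_stepMatrix, List.map_ofFn, Function.comp_def]

end Factors

section Words

section Boxes

variable {α : Type*}

/-- The function on `α` with restriction `v` to the elements satisfying `P` and restriction `w` to
the other ones. -/
def glue {P : α → Prop} [DecidablePred P] (v : {a // P a} → ℤ) (w : {a // ¬ P a} → ℤ) (a : α) :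
    ℤ :=
  if ha : P a then v ⟨a, ha⟩ else w ⟨a, ha⟩

theorem glue_mem_box [Fintype α] {P : α → Prop} [DecidablePred P] {v : {a // P a} → ℤ}
    {w : {a // ¬ P a} → ℤ} {n : ℕ} :
    glue v w ∈ box α n ↔ w ∈ box {a // ¬ P a} n ∧ v ∈ box {a // P a} n := by
  simp only [mem_box, glue, Subtype.forall]
  constructor
  · exact fun h => ⟨fun a ha => by simpa only [dif_neg ha] using h a,
      fun a ha => by simpa only [dif_pos ha] using h a⟩
  · rintro ⟨hw, hv⟩ a
    split_ifs with ha
    exacts [hv a ha, hw a ha]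

theorem sum_box_eq_sum_glue [Fintype α] (P : α → Prop) [DecidablePred P] {M : Type*}
    [AddCommMonoid M] (n : ℕ) (f : (α → ℤ) → M) :
    ∑ x ∈ box α n, f x = ∑ w ∈ box {a // ¬ P a} n, ∑ v ∈ box {a // P a} n, f (glue v w) := by
  rw [← Finset.sum_product']
  exact (Finset.sum_equiv ((Equiv.prodComm _ _).trans (Equiv.piEquivPiSubtypeProd P _).symm)
    (fun y => by rw [Finset.mem_product]; exact glue_mem_box.symm) fun _ _ => rfl).symm

theorem sum_box_option [Fintype α] {M : Type*} [AddCommMonoid M] (n : ℕ)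
    (f : (α → ℤ) → ℤ → M) :
    ∑ x ∈ box (Option α) n, f (x ∘ some) (x none) =
      ∑ v ∈ box α n, ∑ i ∈ Finset.Icc (-(n : ℤ)) n, f v i := by
  rw [← Finset.sum_product_right']
  refine Finset.sum_equiv (Equiv.piOptionEquivProd (β := fun _ => ℤ)) (fun x => ?_) fun _ _ => rfl
  simp [mem_box, Option.forall]

theorem summable_prod_norm [Fintype α] {β E : Type*} [SeminormedAddCommGroup E] {f : α → β → E}
    (hf : ∀ a, Summable fun b => ‖f a b‖) : Summable fun w : α → β => ∏ a, ‖f a (w a)‖ := by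
  classical
  have hnonneg (w : α → β) : 0 ≤ ∏ a, ‖f a (w a)‖ :=
    Finset.prod_nonneg fun _ _ => norm_nonneg _
  refine summable_of_sum_le (c := ∏ a, ∑' b, ‖f a b‖) hnonneg fun s => ?_
  have hsub : s ⊆ Fintype.piFinset fun a => s.image fun w => w a := fun w hw =>
    Fintype.mem_piFinset.2 fun a => Finset.mem_image_of_mem _ hw
  calc ∑ w ∈ s, ∏ a, ‖f a (w a)‖
      ≤ ∑ w ∈ Fintype.piFinset fun a => s.image fun w => w a, ∏ a, ‖f a (w a)‖ :=
        Finset.sum_le_sum_of_subset_of_nonneg hsub fun w _ _ => hnonneg w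
    _ = ∏ a, ∑ b ∈ s.image fun w => w a, ‖f a b‖ :=
        (Finset.prod_univ_sum _ fun a b => ‖f a b‖).symm
    _ ≤ ∏ a, ∑' b, ‖f a b‖ :=
        Finset.prod_le_prod (fun _ _ => Finset.sum_nonneg fun _ _ => norm_nonneg _) fun a _ =>
          (hf a).sum_le_tsum _ fun _ _ => norm_nonneg _

theorem eventually_mem_box [Fintype α] (w : α → ℤ) : ∀ᶠ n in atTop, w ∈ box α n := by
  simp only [mem_box, eventually_all]
  intro a
  filter_upwards [eventually_ge_atTop (w a).natAbs] with n hn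
  omega

theorem exists_tendsto_sum_box [Fintype α] {f : α → ℤ → ℂ} (hf : ∀ a, Summable fun v => ‖f a v‖)
    {G : ℕ → (α → ℤ) → ℂ} {K : ℝ} (hbound : ∀ n, 1 ≤ n → ∀ w, ‖G n w‖ ≤ K)
    (hlim : ∀ w, ∃ L, Tendsto (fun n => G n w) atTop (𝓝 L)) :
    ∃ L, Tendsto (fun n => ∑ w ∈ box α n, (∏ a, f a (w a)) * G n w) atTop (𝓝 L) := by
  classical
  choose L hL using hlim
  let term (n : ℕ) (w : α → ℤ) : ℂ := if w ∈ box α n then (∏ a, f a (w a)) * G n w else 0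
  have hterm (w : α → ℤ) : Tendsto (term · w) atTop (𝓝 ((∏ a, f a (w a)) * L w)) :=
    ((hL w).const_mul _).congr' <| (eventually_mem_box w).mono fun n hn => (if_pos hn).symm
  have hdominated : ∀ᶠ n in atTop, ∀ w, ‖term n w‖ ≤ (∏ a, ‖f a (w a)‖) * K := by
    filter_upwards [eventually_ge_atTop 1] with n hn w
    calc ‖term n w‖ ≤ ‖(∏ a, f a (w a)) * G n w‖ := by
          simp only [term]
          split_ifs
          exacts [le_rfl, norm_zero.trans_le (norm_nonneg _)]
      _ ≤ (∏ a, ‖f a (w a)‖) * K := by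
          rw [norm_mul, norm_prod]
          gcongr
          exact hbound n hn w
  refine ⟨_, (tendsto_tsum_of_dominated_convergence ((summable_prod_norm hf).mul_right K)
    hterm hdominated).congr fun n => ?_⟩
  rw [tsum_eq_sum (s := box α n) fun w hw => if_neg hw]
  exact Finset.sum_congr rfl fun w hw => if_pos hw

end Boxes

variable {Ω κ : Type*}

namespace Factor

/-- A factor is random if its input is. -/
abbrev IsRandom (F : Factor κ) : Prop := F.input.isLeft = true

/-- The array of a random factor, and whether its entries are conjugated. -/
def label (F : Factor κ) (hF : F.IsRandom) : κ × Bool := (F.input.getLeft hF, F.adjoint)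

/-- The coefficients of a deterministic factor; the value for a random factor is `0` by
convention. -/
def weight (F : Factor κ) (v : ℤ) : ℂ :=
  F.input.elim (fun _ => 0) fun c => conjIf F.adjoint (c v)

theorem coef_of_isRandom (u : κ → ℕ → ℤ → Ω → ℂ) (n : ℕ) (ω : Ω) {F : Factor κ}
    (hF : F.IsRandom) (v : ℤ) :
    F.coef u n ω v = ((Real.sqrt n : ℝ) : ℂ)⁻¹ * entry u (F.label hF) n v ω := by
  obtain ⟨k | c, hankel, adjoint⟩ := F
  · rfl
  · exact absurd hF (by simp [IsRandom])

theorem coef_of_not_isRandom (u : κ → ℕ → ℤ → Ω → ℂ) (n : ℕ) (ω : Ω) {F : Factor κ}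
    (hF : ¬ F.IsRandom) (v : ℤ) : F.coef u n ω v = F.weight v := by
  obtain ⟨k | c, hankel, adjoint⟩ := F
  · exact absurd rfl hF
  · rfl

theorem isAffine_step {ι : Type*} [Fintype ι] (F : Factor κ) {v f : ℕ → (ι → ℤ) → ℤ}
    (hv : IsAffine v) (hf : IsAffine f) : IsAffine fun n x => F.step n (v n x) (f n x) := by
  simp only [step]
  split_ifs
  exacts [((IsAffine.scale.sub (.const 1)).sub hf).sub hv, hf.add hv, hf.sub hv]

end Factor

variable {k : ℕ}

/-- The indices `x ∘ some` of the random factors and `w` of the deterministic ones form, together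
with the starting point `x none`, a closed path inside `{0, …, n - 1}`. -/
def IsClosedPath (F : Fin k → Factor κ) (w : {p // ¬ (F p).IsRandom} → ℤ) (n : ℕ)
    (x : Option {p // (F p).IsRandom} → ℤ) : Prop :=
  IsPath n (List.ofFn fun p => (F p).step n (glue (x ∘ some) w p)) (x none) (x none)

theorem isPoly_isClosedPath (F : Fin k → Factor κ) (w : {p // ¬ (F p).IsRandom} → ℤ) :
    IsPoly (IsClosedPath F w) := by
  have hindex (p : Fin k) : IsAffine fun (_ : ℕ) (x : Option {p // (F p).IsRandom} → ℤ) =>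
      glue (x ∘ some) w p := by
    simp only [glue]
    split_ifs with hp
    exacts [IsAffine.coord (some (⟨p, hp⟩ : {p // (F p).IsRandom})), .const _]
  have hpath := isPoly_isPath (List.ofFn fun p n x => (F p).step n (glue (x ∘ some) w p))
    (fun g hg f hf => by
      obtain ⟨p, rfl⟩ := List.mem_ofFn.1 hg
      exact (F p).isAffine_step (hindex p) hf) (.coord none) (.coord none)
  simp only [List.map_ofFn] at hpath
  exact hpath

theorem prod_coef (u : κ → ℕ → ℤ → Ω → ℂ) (F : Fin k → Factor κ) (n : ℕ)
    (v : {p // (F p).IsRandom} → ℤ) (w : {p // ¬ (F p).IsRandom} → ℤ) (ω : Ω) :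
    ∏ p, (F p).coef u n ω (glue v w p) =
      (∏ p : {p // ¬ (F p).IsRandom}, (F p).weight (w p)) *
        ((Real.sqrt n : ℝ) : ℂ)⁻¹ ^ Fintype.card {p // (F p).IsRandom} *
        ∏ p : {p // (F p).IsRandom}, entry u ((F p).label p.2) n (v p) ω := by
  have hrandom (p : {p // (F p).IsRandom}) : (F p).coef u n ω (glue v w p) =
      ((Real.sqrt n : ℝ) : ℂ)⁻¹ * entry u ((F p).label p.2) n (v p) ω := by
    rw [Factor.coef_of_isRandom u n ω p.2, glue, dif_pos p.2]
  have hdet (p : {p // ¬ (F p).IsRandom}) :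
      (F p).coef u n ω (glue v w p) = (F p).weight (w p) := by
    rw [Factor.coef_of_not_isRandom u n ω p.2, glue, dif_neg p.2]
  rw [← Fintype.prod_subtype_mul_prod_subtype fun p => (F p).IsRandom]
  simp only [hrandom, hdet, Finset.prod_mul_distrib, Finset.prod_const, Finset.card_univ]
  ring

open scoped Classical in
theorem momentSum_isClosedPath (F : Fin k → Factor κ) (w : {p // ¬ (F p).IsRandom} → ℤ) (n : ℕ)
    (E : ℕ → ({p // (F p).IsRandom} → ℤ) → ℂ) :
    momentSum E n (IsClosedPath F w n) =
      normFactor (Fintype.card {p // (F p).IsRandom}) n *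
        ∑ v ∈ box {p // (F p).IsRandom} n, E n v * ∑ i ∈ Finset.Icc (-(n : ℤ)) n,
          if IsPath n (List.ofFn fun p => (F p).step n (glue v w p)) i i then 1 else 0 := by
  simp only [momentSum_def, Finset.sum_filter, Finset.mul_sum, mul_ite, mul_one, mul_zero,
    ← sum_box_option]
  rfl

variable [MeasurableSpace Ω] {μ : Measure Ω} {u : κ → ℕ → ℤ → Ω → ℂ} {q : κ → CorrParams}

theorem integrable_prod_coef [IsFiniteMeasure μ] (hu : ∀ k, IsPairCorrelated μ (u k) (q k))
    (F : Fin k → Factor κ) {n : ℕ} (hn : 1 ≤ n) (v : Fin k → ℤ) :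
    Integrable (fun ω => ∏ p, (F p).coef u n ω (v p)) μ := by
  refine (HasMoments.prod _ fun p _ => ?_).integrable
  by_cases hp : (F p).IsRandom
  · simp only [Factor.coef_of_isRandom u n _ hp]
    exact (HasMoments.const _).mul (hasMoments_entry hu hn _ _)
  · simp only [Factor.coef_of_not_isRandom u n _ hp]
    exact HasMoments.const _

theorem expTrace_prod_matrix [IsFiniteMeasure μ] (hu : ∀ k, IsPairCorrelated μ (u k) (q k))
    (F : Fin k → Factor κ) {n : ℕ} (hn : 1 ≤ n) :
    expTrace μ (fun ω => (List.ofFn fun p => (F p).matrix u n ω).prod) =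
      ∑ w ∈ box {p // ¬ (F p).IsRandom} n,
        (∏ p : {p // ¬ (F p).IsRandom}, (F p).weight (w p)) *
          momentSum (jointMoment μ u fun p : {p // (F p).IsRandom} => (F p).label p.2) n
            (IsClosedPath F w n) := by
  simp only [expTrace, trace_prod_matrix]
  rw [integral_finsetSum _ fun v _ => (integrable_prod_coef hu F hn v).mul_const _]
  simp only [integral_mul_const]
  rw [sum_box_eq_sum_glue fun p => (F p).IsRandom, Finset.mul_sum]
  refine Finset.sum_congr rfl fun w _ => ?_
  simp only [prod_coef, integral_const_mul, momentSum_isClosedPath, normFactor, Finset.mul_sum,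
    jointMoment]
  refine Finset.sum_congr rfl fun v _ => Finset.sum_congr rfl fun i _ => ?_
  ring

theorem tendsto_expTrace_prod_matrix [IsFiniteMeasure μ]
    (hu : ∀ k, IsPairCorrelated μ (u k) (q k))
    (hindep : ∀ n, 1 ≤ n → iIndepFun (fun (k : κ) (ω : Ω) (j : ℤ) => u k n j ω) μ)
    (F : Fin k → Factor κ) (hF : ∀ p, Summable fun v => ‖(F p).weight v‖) :
    ∃ L : ℂ, Tendsto (fun n : ℕ =>
      expTrace μ (fun ω => (List.ofFn fun p => (F p).matrix u n ω).prod)) atTop (𝓝 L) := by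
  have hE := isMomentFunction_jointMoment hu hindep
    fun p : {p // (F p).IsRandom} => (F p).label p.2
  obtain ⟨K, hK⟩ := hE.exists_bound
  obtain ⟨L, hL⟩ := exists_tendsto_sum_box (fun p : {p // ¬ (F p).IsRandom} => hF p)
    (fun n hn w => hK n hn (IsClosedPath F w n))
    fun w => hE.tendsto_momentSum (isPoly_isClosedPath F w)
  refine ⟨L, hL.congr' ?_⟩
  filter_upwards [eventually_ge_atTop 1] with n hn
  exact (expTrace_prod_matrix hu F hn).symm

theorem summable_weight_factor {m : ℕ} (t h : Fin m → κ) {d e : Fin m → ℤ → ℂ}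
    (hd : ∀ i, Summable fun k => ‖d i k‖) (he : ∀ i, Summable fun k => ‖e i k‖) (b : Bool)
    (l : Label m) : Summable fun v => ‖(l.factor t h d e b).weight v‖ := by
  rcases l with i | i | i | i | _ <;>
    simp only [Label.factor, Factor.weight, Sum.elim_inl, Sum.elim_inr, norm_zero, norm_conjIf]
  exacts [summable_zero, summable_zero, hd i, he i, summable_of_hasFiniteSupport <|
    (Set.finite_singleton 0).subset fun v hv => by_contra fun h0 => hv (by simp_all)]

theorem tendsto_expTrace_starWord_collection [IsFiniteMeasure μ]
    (hu : ∀ k, IsPairCorrelated μ (u k) (q k))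
    (hindep : ∀ n, 1 ≤ n → iIndepFun (fun (k : κ) (ω : Ω) (j : ℤ) => u k n j ω) μ)
    {m : ℕ} (t h : Fin m → κ) {d e : Fin m → ℤ → ℂ}
    (hd : ∀ i, Summable fun k => ‖d i k‖) (he : ∀ i, Summable fun k => ‖e i k‖)
    (w : List (Label m × Bool)) :
    ∃ L : ℂ, Tendsto (fun n : ℕ => expTrace μ fun ω =>
      starWord (fun l => collection (fun i => u (t i)) (fun i => u (h i)) d e l n ω) w)
      atTop (𝓝 L) := by
  obtain ⟨L, hL⟩ := tendsto_expTrace_prod_matrix hu hindep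
    (fun p => (w.get p).1.factor t h d e (w.get p).2)
    fun p => summable_weight_factor t h hd he _ _
  refine ⟨L, hL.congr fun n => ?_⟩
  congr 1
  funext ω
  rw [starWord_collection, ← List.ofFn_get (w.map _), List.map_ofFn]
  simp

end Words

section FreeStarAlgebra

variable {ι : Type*}

/-- The free unital complex algebra on the letters `x i` and `(x i)*`. -/
abbrev FreeStar (ι : Type*) : Type _ := MonoidAlgebra ℂ (FreeMonoid (ι × Bool))

/-- The adjoint of a word. -/
def wordStar (w : FreeMonoid (ι × Bool)) : FreeMonoid (ι × Bool) :=
  FreeMonoid.ofList (w.toList.reverse.map fun l => (l.1, !l.2))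

theorem wordStar_mul (v w : FreeMonoid (ι × Bool)) :
    wordStar (v * w) = wordStar w * wordStar v := by
  simp [wordStar, FreeMonoid.toList_mul, FreeMonoid.ofList_append]

theorem wordStar_wordStar (w : FreeMonoid (ι × Bool)) : wordStar (wordStar w) = w := by
  simp [wordStar, Function.comp_def]

/-- The conjugate-linear extension of the adjoint of words. -/
def freeStarHom (ι : Type*) : FreeStar ι →+ FreeStar ι :=
  MonoidAlgebra.liftNC ((MonoidAlgebra.singleAddHom 1).comp (starAddEquiv : ℂ ≃+ ℂ).toAddMonoidHom)
    fun w => MonoidAlgebra.single (wordStar w) 1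

theorem freeStarHom_single (w : FreeMonoid (ι × Bool)) (c : ℂ) :
    freeStarHom ι (MonoidAlgebra.single w c) = MonoidAlgebra.single (wordStar w) (star c) := by
  rw [freeStarHom, MonoidAlgebra.liftNC_single]
  simp [MonoidAlgebra.singleAddHom, MonoidAlgebra.single_mul_single]

theorem freeStarHom_mul (f g : FreeStar ι) :
    freeStarHom ι (f * g) = freeStarHom ι g * freeStarHom ι f := by
  induction f using MonoidAlgebra.induction_linear with
  | zero => simp
  | add f f' hf hf' => rw [add_mul, map_add, map_add, hf, hf', mul_add]
  | single v c =>
    induction g using MonoidAlgebra.induction_linear with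
    | zero => simp
    | add g g' hg hg' => rw [mul_add, map_add, map_add, hg, hg', add_mul]
    | single w d =>
      simp only [MonoidAlgebra.single_mul_single, freeStarHom_single, wordStar_mul, star_mul]

instance : StarRing (FreeStar ι) where
  star := freeStarHom ι
  star_involutive f := by
    induction f using MonoidAlgebra.induction_linear with
    | zero => simp
    | add f g hf hg => rw [map_add, map_add, hf, hg]
    | single w c => rw [freeStarHom_single, freeStarHom_single, wordStar_wordStar, star_star]
  star_mul := freeStarHom_mul
  star_add f g := map_add _ f g

theorem star_single (w : FreeMonoid (ι × Bool)) (c : ℂ) :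
    star (MonoidAlgebra.single w c : FreeStar ι) = MonoidAlgebra.single (wordStar w) (star c) :=
  freeStarHom_single w c

instance : StarModule ℂ (FreeStar ι) where
  star_smul c f := by
    induction f using MonoidAlgebra.induction_linear with
    | zero => simp
    | add f g hf hg => rw [smul_add, star_add, star_add, hf, hg, smul_add]
    | single w d =>
      simp only [MonoidAlgebra.smul_single, star_single, smul_eq_mul, star_mul, mul_comm]

variable {R : Type*} [Ring R] [StarRing R]

theorem starWord_wordStar (x : ι → R) (w : FreeMonoid (ι × Bool)) :
    starWord x (wordStar w).toList = star (starWord x w.toList) := by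
  simp only [starWord, wordStar, FreeMonoid.toList_ofList]
  generalize w.toList = l
  induction l with
  | nil => simp
  | cons a l ih =>
    simp only [List.reverse_cons, List.map_append, List.prod_append, ih, List.map_cons,
      List.prod_cons, star_mul, List.map_nil, List.prod_nil, mul_one]
    rcases a with ⟨a, _ | _⟩ <;> simp

variable [Algebra ℂ R]

/-- Evaluation of noncommutative `*`-polynomials. -/
def evalStar (x : ι → R) : FreeStar ι →ₐ[ℂ] R :=
  MonoidAlgebra.lift ℂ R _ (FreeMonoid.lift fun l : ι × Bool =>
    if l.2 then star (x l.1) else x l.1)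

theorem evalStar_single (x : ι → R) (w : FreeMonoid (ι × Bool)) (c : ℂ) :
    evalStar x (MonoidAlgebra.single w c) = c • starWord x w.toList := by
  rw [evalStar, MonoidAlgebra.lift_single, FreeMonoid.lift_apply, starWord]

theorem evalStar_star [StarModule ℂ R] (x : ι → R) (f : FreeStar ι) :
    evalStar x (star f) = star (evalStar x f) := by
  induction f using MonoidAlgebra.induction_linear with
  | zero => simp
  | add f g hf hg => rw [star_add, map_add, map_add, hf, hg, star_add]
  | single w c => rw [star_single, evalStar_single, evalStar_single, starWord_wordStar, star_smul]

/-- The generators of the free `*`-algebra. -/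
def freeGen (i : ι) : FreeStar ι := MonoidAlgebra.single (FreeMonoid.of (i, false)) 1

theorem starWord_freeGen (w : List (ι × Bool)) :
    starWord (freeGen (ι := ι)) w = MonoidAlgebra.single (FreeMonoid.ofList w) 1 := by
  induction w with
  | nil => rfl
  | cons a w ih =>
    have hletter : (if a.2 then star (freeGen a.1) else freeGen a.1 : FreeStar ι) =
        MonoidAlgebra.single (FreeMonoid.of a) 1 := by
      rcases a with ⟨a, _ | _⟩
      · rfl
      · simp [freeGen, star_single, wordStar]
    simp only [starWord, List.map_cons, List.prod_cons, hletter] at ih ⊢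
    rw [ih, MonoidAlgebra.single_mul_single, one_mul, ← FreeMonoid.ofList_cons]

/-- The linear functional on the free `*`-algebra with prescribed values on words. -/
def freeFunctional (L : List (ι × Bool) → ℂ) : FreeStar ι →ₗ[ℂ] ℂ where
  toFun f := Finsupp.linearCombination ℂ (fun w : FreeMonoid (ι × Bool) => L w.toList) f.coeff
  map_add' f g := by simp
  map_smul' c f := by simp

theorem freeFunctional_single (L : List (ι × Bool) → ℂ) (w : FreeMonoid (ι × Bool)) (c : ℂ) :
    freeFunctional L (MonoidAlgebra.single w c) = c * L w.toList := by
  simp [freeFunctional]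

end FreeStarAlgebra

section Limit

variable {Ω : Type*} [MeasurableSpace Ω] {μ : Measure Ω} {n : ℕ}

theorem HasAllMoments.mul {A B : Ω → Matrix (Fin n) (Fin n) ℂ} (hA : HasAllMoments μ A)
    (hB : HasAllMoments μ B) : HasAllMoments μ fun ω => A ω * B ω := by
  intro i j
  simp only [Matrix.mul_apply]
  exact HasMoments.sum (μ := μ) _ fun k _ => HasMoments.mul (hA i k) (hB k j)

theorem HasAllMoments.star {A : Ω → Matrix (Fin n) (Fin n) ℂ} (hA : HasAllMoments μ A) :
    HasAllMoments μ fun ω => star (A ω) := by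
  intro i j
  simp only [Matrix.star_apply]
  exact HasMoments.star (μ := μ) (hA j i)

theorem HasAllMoments.add {A B : Ω → Matrix (Fin n) (Fin n) ℂ} (hA : HasAllMoments μ A)
    (hB : HasAllMoments μ B) : HasAllMoments μ fun ω => A ω + B ω :=
  fun i j p => (hA i j p).add (hB i j p)

theorem HasAllMoments.smul {A : Ω → Matrix (Fin n) (Fin n) ℂ} (hA : HasAllMoments μ A) (c : ℂ) :
    HasAllMoments μ fun ω => c • A ω :=
  fun i j p => (hA i j p).const_smul c

theorem HasAllMoments.const [IsFiniteMeasure μ] (A : Matrix (Fin n) (Fin n) ℂ) :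
    HasAllMoments μ fun _ => A :=
  fun i j _ => memLp_const (A i j)

theorem HasAllMoments.integrable_trace {A : Ω → Matrix (Fin n) (Fin n) ℂ}
    (hA : HasAllMoments μ A) : Integrable (fun ω => (A ω).trace) μ :=
  integrable_finsetSum _ fun i _ => HasMoments.integrable (μ := μ) (hA i i)

theorem HasAllMoments.starWord [IsFiniteMeasure μ] {ι : Type*}
    {A : ι → Ω → Matrix (Fin n) (Fin n) ℂ} (hA : ∀ i, HasAllMoments μ (A i))
    (w : List (ι × Bool)) : HasAllMoments μ fun ω => starWord (fun i => A i ω) w := by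
  induction w with
  | nil => exact HasAllMoments.const 1
  | cons a w ih =>
    simp only [ToeplitzHankel.starWord, List.map_cons, List.prod_cons] at ih ⊢
    refine HasAllMoments.mul ?_ ih
    rcases a with ⟨a, _ | _⟩
    · simpa using hA a
    · simpa using (hA a).star

theorem HasAllMoments.evalStar [IsFiniteMeasure μ] {ι : Type*}
    {A : ι → Ω → Matrix (Fin n) (Fin n) ℂ} (hA : ∀ i, HasAllMoments μ (A i))
    (f : FreeStar ι) : HasAllMoments μ fun ω => evalStar (fun i => A i ω) f := by
  induction f using MonoidAlgebra.induction_linear with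
  | zero => simpa using HasAllMoments.const (μ := μ) (n := n) 0
  | add f g hf hg => simpa using hf.add hg
  | single w c =>
    simp only [evalStar_single]
    exact (HasAllMoments.starWord hA w.toList).smul c

theorem expTrace_smul (c : ℂ) (A : Ω → Matrix (Fin n) (Fin n) ℂ) :
    expTrace μ (fun ω => c • A ω) = c * expTrace μ A := by
  simp only [expTrace, Matrix.trace_smul, smul_eq_mul, integral_const_mul]
  ring

open scoped ComplexOrder in
theorem expTrace_mul_star_nonneg (A : Ω → Matrix (Fin n) (Fin n) ℂ) :
    0 ≤ expTrace μ fun ω => A ω * star (A ω) :=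
  mul_nonneg (by positivity) <| integral_nonneg fun ω =>
    (Matrix.posSemidef_self_mul_conjTranspose (A ω)).trace_nonneg

section FreeFunctional

variable {ι : Type*} {A : ι → (n : ℕ) → Ω → Matrix (Fin n) (Fin n) ℂ} {L : List (ι × Bool) → ℂ}

theorem tendsto_expTrace_evalStar [IsFiniteMeasure μ]
    (hA : ∀ i n, 1 ≤ n → HasAllMoments μ (A i n))
    (hL : ∀ w, Tendsto (fun n => expTrace μ fun ω => starWord (fun i => A i n ω) w) atTop
      (𝓝 (L w)))
    (f : FreeStar ι) :
    Tendsto (fun n => expTrace μ fun ω => evalStar (fun i => A i n ω) f) atTop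
      (𝓝 (freeFunctional L f)) := by
  induction f using MonoidAlgebra.induction_linear with
  | zero => simp [expTrace]
  | add f g hf hg =>
    rw [map_add]
    refine (hf.add hg).congr' ?_
    filter_upwards [eventually_ge_atTop 1] with n hn
    simp only [expTrace, map_add, Matrix.trace_add]
    rw [integral_add (HasAllMoments.evalStar (fun i => hA i n hn) f).integrable_trace
      (HasAllMoments.evalStar (fun i => hA i n hn) g).integrable_trace, mul_add]
  | single w c =>
    simp only [evalStar_single, expTrace_smul, freeFunctional_single]
    exact (hL w.toList).const_mul c

open scoped ComplexOrder in
theorem isState_freeFunctional [IsProbabilityMeasure μ]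
    (hA : ∀ i n, 1 ≤ n → HasAllMoments μ (A i n))
    (hL : ∀ w, Tendsto (fun n => expTrace μ fun ω => starWord (fun i => A i n ω) w) atTop
      (𝓝 (L w))) :
    IsState (freeFunctional L) where
  map_one := by
    refine tendsto_nhds_unique (tendsto_expTrace_evalStar hA hL 1)
      (tendsto_const_nhds.congr' ?_)
    filter_upwards [eventually_ne_atTop 0] with n hn
    simp [expTrace, hn]
  nonneg f := by
    have hnonneg : 0 ≤ freeFunctional L (f * star f) :=
      ge_of_tendsto' (tendsto_expTrace_evalStar hA hL (f * star f)) fun n => by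
        simpa only [map_mul, evalStar_star] using expTrace_mul_star_nonneg _
    obtain ⟨r, hr, heq⟩ := RCLike.nonneg_iff_exists_ofReal.1 hnonneg
    exact ⟨r, hr, heq.symm⟩

end FreeFunctional

theorem convergeJointly_of_tendsto [IsProbabilityMeasure μ] {ι : Type}
    {A : ι → (n : ℕ) → Ω → Matrix (Fin n) (Fin n) ℂ}
    (hA : ∀ i n, 1 ≤ n → HasAllMoments μ (A i n))
    (hlim : ∀ w : List (ι × Bool), ∃ L : ℂ,
      Tendsto (fun n => expTrace μ fun ω => starWord (fun i => A i n ω) w) atTop (𝓝 L)) :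
    ConvergeJointly μ A := by
  choose L hL using hlim
  refine ⟨hA, FreeStar ι, inferInstance, inferInstance, inferInstance, inferInstance,
    freeFunctional L, freeGen, isState_freeFunctional hA hL, fun w => ?_⟩
  rw [starWord_freeGen, freeFunctional_single, one_mul]
  exact hL w

theorem hasAllMoments_toeplitz {a : ℤ → Ω → ℂ} (ha : ∀ j, HasMoments μ (a j)) :
    HasAllMoments μ fun ω => toeplitz (fun j => a j ω) n :=
  fun i j => ha (((i : ℕ) : ℤ) - ((j : ℕ) : ℤ))

theorem hasAllMoments_collection [IsFiniteMeasure μ] {m : ℕ} {a b : Fin m → ℕ → ℤ → Ω → ℂ}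
    (ha : ∀ i j, HasMoments μ (a i n j)) (hb : ∀ i j, HasMoments μ (b i n j))
    (d e : Fin m → ℤ → ℂ) (l : Label m) : HasAllMoments μ (collection a b d e l n) := by
  rcases l with i | i | i | i | _
  · exact (hasAllMoments_toeplitz (ha i)).smul _
  · exact ((HasAllMoments.const (backwardIdentity n)).mul (hasAllMoments_toeplitz (hb i))).smul _
  · exact .const _
  · exact .const _
  · exact .const _

end Limit

end ToeplitzHankel

end

open ToeplitzHankel in
theorem corollary2p1_general {Ω κ : Type*} [MeasurableSpace Ω] (μ : Measure Ω)
    [IsProbabilityMeasure μ] {m : ℕ} (u : κ → ℕ → ℤ → Ω → ℂ) (q : κ → CorrParams)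
    (hu : ∀ k, IsPairCorrelated μ (u k) (q k))
    (hindep : ∀ n, 1 ≤ n → iIndepFun (fun (k : κ) (ω : Ω) (j : ℤ) => u k n j ω) μ)
    (t h : Fin m → κ) (d e : Fin m → ℤ → ℂ)
    (hd : ∀ i, Summable fun k => ‖d i k‖) (he : ∀ i, Summable fun k => ‖e i k‖) :
    ConvergeJointly μ (collection (fun i => u (t i)) (fun i => u (h i)) d e) :=
  convergeJointly_of_tendsto
    (fun l _ hn => hasAllMoments_collection (fun i => (hu (t i)).hasMoments hn)
      (fun i => (hu (h i)).hasMoments hn) d e l)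
    (tendsto_expTrace_starWord_collection hu hindep t h hd he)

/-- `u 0, …, u (r - 1)` are independent input arrays, each satisfying the pair-correlation
assumption. The `i`-th random Toeplitz matrix has input `u (t i)` and the `i`-th random symmetric
Hankel matrix has input `u (h i)`; as `t` and `h` are injective, each of these two families consists
of independent matrices. The two families are independent of each other if `t` and `h` have disjoint
ranges, and are allowed to share inputs otherwise. -/
theorem corollary2p1 {Ω : Type*} [MeasurableSpace Ω] (μ : MeasureTheory.Measure Ω)
    [MeasureTheory.IsProbabilityMeasure μ] (r m : ℕ)
    (u : Fin r → ℕ → ℤ → Ω → ℂ) (q : Fin r → ToeplitzHankel.CorrParams)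
    (hu : ∀ k, ToeplitzHankel.IsPairCorrelated μ (u k) (q k))
    (hindep : ∀ n, 1 ≤ n →
      ProbabilityTheory.iIndepFun (fun (k : Fin r) (ω : Ω) (j : ℤ) => u k n j ω) μ)
    (t h : Fin m → Fin r) (ht : Function.Injective t) (hh : Function.Injective h)
    (d e : Fin m → ℤ → ℂ)
    (hd : ∀ i, Summable fun k => ‖d i k‖) (he : ∀ i, Summable fun k => ‖e i k‖) :
    ToeplitzHankel.ConvergeJointly μ
      (ToeplitzHankel.collection (fun i => u (t i)) (fun i => u (h i)) d e) :=
  corollary2p1_general μ u q hu hindep t h d e hd he
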